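/- Let $v>0$ be known. For $\lambda>0$ let $P_\lambda$ be a probability measure under which $N=(N(t))_{t\ge 0}$ is a homogeneous Poisson process with rate $\lambda$, and $V(0)$ is a random variable, independent of $N$, that takes each of the values $v$ and $-v$ with probability $1/2$. Let $$X(t)=V(0)\int_0^t(-1)^{N(s)}\,ds,\qquad t\ge 0,$$ be the telegraph process. Let $\Delta_n>0$ with $\Delta_n\to 0$ and $T_n:=n\Delta_n\to\infty$ as $n\to\infty$. The process is observed at the times $i\Delta_n$, $i=0,\dots,n$; put $\eta_i=X(i\Delta_n)-X((i-1)\Delta_n)$ for $1\le i\le n$ and $$\tilde\lambda_n=\frac1{n\Delta_n}\sum_{i=1}^n\mathbf 1_{\{|\eta_i|<v\Delta_n\}},\qquad \hat\lambda_n=-\frac1{\Delta_n}\log\bigl(1-\Delta_n\tilde\lambda_n\bigr),$$ where $\hat\lambda_n:=0$ if all $n$ indicators are equal to $1$. Then, for every fixed $\lambda_0>0$: 1. $\hat\lambda_n$ is consistent: $\hat\lambda_n\to\lambda_0$ in $P_{\lambda_0}$-probability. 2. $\hat\lambda_n$ is asymptotically normal: $\sqrt{n\Delta_n}\,(\hat\lambda_n-\lambda_0)\to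 N(0,\lambda_0)$ in distribution under $P_{\lambda_0}$. 3. $\hat\lambda_n$ attains the minimum asymptotic variance, that is, it is asymptotically efficient, even with respect to the experiment in which $V(0)$ and $(N(t))_{t\le T_n}$ (hence $X$ on $[0,T_n]$) are observed continuously. Here a sequence $S_n$ of estimators, $S_n$ a measurable function of $V(0)$ and $(N(t))_{t\le T_n}$, is called regular at $\lambda_0$ with limit law $L$ (a probability measure on $\mathbb R$) if for every $h\in\mathbb R$ the law of $\sqrt{T_n}\,(S_n-\lambda_n)$ under $P_{\lambda_n}$, where $\lambda_n=\lambda_0+h/\sqrt{T_n}$ (positive for all large $n$), converges weakly to $L$. The claim is that $\hat\lambda_n$ is regular at $\lambda_0$ with limit law $N(0,\lambda_0)$, and that for every sequence $S_n$ that is regular at $\lambda_0$ with some limit law $L$, the variance of $L$ (in $[0,\infty]$) is at least $\lambda_0$. -/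

import Mathlib

open MeasureTheory ProbabilityTheory Filter Topology

open scoped NNReal ENNReal

noncomputable section

namespace Telegraph

variable {Ω : Type*} [mΩ : MeasurableSpace Ω]

/-- `N` is, under the probability measure `μ`, a homogeneous Poisson (counting) process with
rate `r`: it starts at zero, its paths are nondecreasing and right-continuous with values in `ℕ`,
it has independent increments, and its increment over an interval of length `t - s` has the
Poisson distribution with mean `r * (t - s)`. (The subtraction of natural numbers is harmless
because the paths are nondecreasing.) -/
structure IsPoissonProcess (N : ℝ≥0 → Ω → ℕ) (r : ℝ) (μ : Measure Ω) : Prop where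
  measurable : ∀ t, Measurable (N t)
  zero : ∀ ω, N 0 ω = 0
  mono : ∀ ω, Monotone fun t => N t ω
  rightCont : ∀ ω t, ContinuousWithinAt (fun s => N s ω) (Set.Ici t) t
  indepIncrements : HasIndepIncrements N μ
  law_increment : ∀ s t : ℝ≥0, s ≤ t →
    HasLaw (fun ω => N t ω - N s ω) (poissonMeasure (r * ((t : ℝ) - s)).toNNReal) μ

/-- Under `μ`, the pair `(V₀, N)` drives a telegraph process with speed `v` and rate `r`:
`N` is a Poisson process with rate `r`, and the initial velocity `V₀` takes each of the values
`v` and `-v` with probability `1/2` and is independent of the whole process `N`. -/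
structure IsTelegraph (v : ℝ) (V₀ : Ω → ℝ) (N : ℝ≥0 → Ω → ℕ) (r : ℝ) (μ : Measure Ω) : Prop where
  poisson : IsPoissonProcess N r μ
  measurable_velocity : Measurable V₀
  prob_pos : μ {ω | V₀ ω = v} = 1 / 2
  prob_neg : μ {ω | V₀ ω = -v} = 1 / 2
  indep : IndepFun V₀ (fun ω t => N t ω) μ

/-- The telegraph process `X(t) = V₀ ∫₀ᵗ (-1)^{N(s)} ds`, for `t ≥ 0`. -/
def position (V₀ : Ω → ℝ) (N : ℝ≥0 → Ω → ℕ) (t : ℝ) (ω : Ω) : ℝ :=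
  V₀ ω * ∫ s in (0 : ℝ)..t, (-1 : ℝ) ^ N s.toNNReal ω

/-- The increment `η_i = X(i Δ) - X((i - 1) Δ)` of a process `X`. -/
def increment (X : ℝ → Ω → ℝ) (Δ : ℝ) (i : ℕ) (ω : Ω) : ℝ :=
  X (i * Δ) ω - X (((i : ℝ) - 1) * Δ) ω

open Classical in
/-- The statistic `(1 / (n Δ)) ∑_{i=1}^n 1{|η_i| < v Δ}`. -/
def lamTilde (v : ℝ) (X : ℝ → Ω → ℝ) (Δ : ℝ) (n : ℕ) (ω : Ω) : ℝ :=
  1 / (n * Δ) * ∑ i ∈ Finset.Icc 1 n, if |increment X Δ i ω| < v * Δ then (1 : ℝ) else 0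

/-- The estimator `-(1 / Δ) log (1 - Δ * lamTilde)`. If all `n` indicators equal one, then the
argument of the logarithm is zero and the convention `Real.log 0 = 0` gives the value `0`. -/
def lamHat (v : ℝ) (X : ℝ → Ω → ℝ) (Δ : ℝ) (n : ℕ) (ω : Ω) : ℝ :=
  -(1 / Δ) * Real.log (1 - Δ * lamTilde v X Δ n ω)

/-- The events observable in the continuous-time experiment on `[0, T]`, in which the initial
velocity and all the switching times up to `T` (hence also the path of the telegraph process
on `[0, T]`) are seen. -/
abbrev observed (V₀ : Ω → ℝ) (N : ℝ≥0 → Ω → ℕ) (T : ℝ) : MeasurableSpace Ω :=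
  MeasurableSpace.comap V₀ inferInstance ⊔
    ⨆ s : {s : ℝ≥0 // (s : ℝ) ≤ T}, MeasurableSpace.comap (N s) inferInstance

/-- In the experiments `(P θ)_{θ > 0}` with information `𝓕 n` and horizon `T n` at stage `n`, the
sequence of estimators `S` is regular at `θ₀` with limit law `L`: each `S n` is a function of the
data of stage `n`, and for every `h`, along the local parameters `θ n = θ₀ + h / √(T n)`, the law of
`√(T n) * (S n - θ n)` under `P (θ n)` converges weakly to `L`, which does not depend on `h`.
(As `θ₀ + h / √(T n)` is only eventually positive, finitely many `θ n` are left arbitrary.) -/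
def IsRegularAt (P : Set.Ioi (0 : ℝ) → Measure Ω) [∀ θ, IsProbabilityMeasure (P θ)]
    (𝓕 : ℕ → MeasurableSpace Ω) (T : ℕ → ℝ) (S : ℕ → Ω → ℝ) (θ₀ : Set.Ioi (0 : ℝ))
    (L : Measure ℝ) [IsProbabilityMeasure L] : Prop :=
  (∀ n, Measurable[𝓕 n] (S n)) ∧
    ∀ (h : ℝ) (θ : ℕ → Set.Ioi (0 : ℝ)),
      (∀ᶠ n in atTop, (θ n : ℝ) = θ₀ + h / √(T n)) →
      TendstoInDistribution (fun n ω => √(T n) * (S n ω - θ n)) atTop (id : ℝ → ℝ)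
        (fun n => P (θ n)) L

/-- The sequence of estimators `S` is asymptotically efficient at `θ₀` with limit law `L`: it is
regular with limit law `L`, and its asymptotic variance, the variance of `L`, is the smallest one
among all regular sequences of estimators. The variance takes values in `[0, ∞]`. -/
def IsEfficientAt (P : Set.Ioi (0 : ℝ) → Measure Ω) [∀ θ, IsProbabilityMeasure (P θ)]
    (𝓕 : ℕ → MeasurableSpace Ω) (T : ℕ → ℝ) (S : ℕ → Ω → ℝ) (θ₀ : Set.Ioi (0 : ℝ))
    (L : Measure ℝ) [IsProbabilityMeasure L] : Prop :=
  IsRegularAt P 𝓕 T S θ₀ L ∧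
    ∀ (S' : ℕ → Ω → ℝ) (L' : Measure ℝ) [IsProbabilityMeasure L'],
      IsRegularAt P 𝓕 T S' θ₀ L' → evariance id L ≤ evariance id L'

end Telegraph

end

noncomputable section

namespace Telegraph

variable {Ω : Type*} [mΩ : MeasurableSpace Ω]

/-! On a sampling interval without a switch the process moves exactly `v * Δ`; once the velocity
takes both signs there, it moves strictly less. So almost surely the indicators record which
intervals contain a Poisson jump (`IsTelegraph.ae_abs_increment_lt_iff`). They are independent with
success probability `p = 1 - exp (-(θ * Δ))`, and `lamHat` is the inverse of this relation applied
to the empirical frequency.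

Upper half: a central limit theorem for rare events (`tendstoInDistribution_sum_indicator`) handles
the centered count. The logarithm is then linearized with an error negligible by tightness
(`abs_sqrt_mul_log_sub_linear_le`). All this is done along arbitrary parameters `θ n → θ₀`, so
`tendstoInDistribution_lamHat` yields both asymptotic normality and regularity; consistency follows
from normality.

Lower half: the continuous data have likelihood ratio `(a / b) ^ N(T) * exp (-((a - b) * T))`, whose
second moment is `exp (T * (a - b) ^ 2 / b)`. Cauchy–Schwarz gives a Chapman–Robbins bound, and with
`a - b = h / √T` its right-hand factor is free of `n`. Applied to truncated, rescaled estimators, it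
passes to the limit law because regularity makes a parameter shift by `h` a shift of the limit by
`h`. Removing the truncation gives `h ^ 2 ≤ Var L * (exp (h ^ 2 / θ₀) - 1)`, and `h → 0` gives `θ₀ ≤
Var L`. No convolution theorem is needed. -/

/-! ### Jumps of a Poisson process -/

theorem IsPoissonProcess.prob_increment_eq_zero {N : ℝ≥0 → Ω → ℕ} {r : ℝ} {μ : Measure Ω}
    (hN : IsPoissonProcess N r μ) (hr : 0 ≤ r) {s t : ℝ≥0} (hst : s ≤ t) :
    μ {ω | N t ω = N s ω} = ENNReal.ofReal (Real.exp (-(r * ((t : ℝ) - s)))) := by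
  have h := hN.law_increment s t hst
  have h0 : 0 ≤ r * ((t : ℝ) - s) := mul_nonneg hr (sub_nonneg.2 (by exact_mod_cast hst))
  have hset : {ω | N t ω = N s ω} = (fun ω => N t ω - N s ω) ⁻¹' {0} := by
    ext ω
    have := hN.mono ω hst
    simp only [Set.mem_ofPred_eq, Set.mem_preimage, Set.mem_singleton_iff]
    simp only at this
    omega
  rw [hset, ← Measure.map_apply_of_aemeasurable h.aemeasurable (measurableSet_singleton 0),
    h.map_eq, poissonMeasure_singleton]
  simp [Real.coe_toNNReal _ h0]

theorem IsPoissonProcess.prob_increment_pos {N : ℝ≥0 → Ω → ℕ} {r : ℝ} {μ : Measure Ω}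
    [IsProbabilityMeasure μ]
    (hN : IsPoissonProcess N r μ) (hr : 0 ≤ r) {s t : ℝ≥0} (hst : s ≤ t) :
    μ.real {ω | N s ω < N t ω} = 1 - Real.exp (-(r * ((t : ℝ) - s))) := by
  have hset : {ω | N s ω < N t ω} = {ω | N t ω = N s ω}ᶜ := by
    ext ω
    have := hN.mono ω hst
    simp only [Set.mem_ofPred_eq, Set.mem_compl_iff]
    simp only at this
    omega
  rw [hset, probReal_compl_eq_one_sub (measurableSet_eq_fun (hN.measurable t) (hN.measurable s)),
    measureReal_def, hN.prob_increment_eq_zero hr hst, ENNReal.toReal_ofReal (Real.exp_pos _).le]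

theorem IsPoissonProcess.prob_increment_pos_le {N : ℝ≥0 → Ω → ℕ} {r : ℝ} {μ : Measure Ω}
    [IsProbabilityMeasure μ]
    (hN : IsPoissonProcess N r μ) (hr : 0 ≤ r) {s t : ℝ≥0} (hst : s ≤ t) :
    μ.real {ω | N s ω < N t ω} ≤ r * ((t : ℝ) - s) := by
  rw [hN.prob_increment_pos hr hst]
  linarith [Real.add_one_le_exp (-(r * ((t : ℝ) - s)))]

/-- The quadratic order is the point: summed over the cells of a mesh, these probabilities vanish as
the mesh is refined. -/
theorem IsPoissonProcess.prob_increment_ge_two_le {N : ℝ≥0 → Ω → ℕ} {r : ℝ} {μ : Measure Ω}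
    [IsProbabilityMeasure μ]
    (hN : IsPoissonProcess N r μ) (hr : 0 ≤ r) {s t : ℝ≥0} (hst : s ≤ t) :
    μ.real {ω | N s ω + 2 ≤ N t ω} ≤ (r * ((t : ℝ) - s)) ^ 2 := by
  have h := hN.law_increment s t hst
  set x := r * ((t : ℝ) - s) with hx
  have h0 : 0 ≤ x := mul_nonneg hr (sub_nonneg.2 (by exact_mod_cast hst))
  have hset : {ω | N s ω + 2 ≤ N t ω} = (fun ω => N t ω - N s ω) ⁻¹' ({0, 1} : Set ℕ)ᶜ := by
    ext ω
    have := hN.mono ω hst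
    simp only [Set.mem_ofPred_eq, Set.mem_preimage, Set.mem_compl_iff, Set.mem_insert_iff,
      Set.mem_singleton_iff]
    simp only at this
    omega
  have hm : ({0, 1} : Set ℕ) = ({0} : Set ℕ) ∪ {1} := rfl
  rw [hset, ← map_measureReal_apply_of_aemeasurable h.aemeasurable (MeasurableSet.of_discrete),
    h.map_eq, probReal_compl_eq_one_sub MeasurableSet.of_discrete, hm,
    measureReal_union (by simp) MeasurableSet.of_discrete, poissonMeasure_real_singleton,
    poissonMeasure_real_singleton]
  simp only [Real.coe_toNNReal _ h0, pow_zero, pow_one, Nat.factorial_zero, Nat.factorial_one,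
    Nat.cast_one, div_one, mul_one]
  -- `1 - (1 + x) * exp (-x) ≤ 1 - (1 + x) * (1 - x) = x ^ 2`.
  nlinarith [Real.add_one_le_exp (-x)]

/-- Almost surely, if a Poisson process jumps in `(a, b]`, its increment over `[a, s]` is one
for some `s < b`. -/
theorem IsPoissonProcess.ae_exists_unit_increment {N : ℝ≥0 → Ω → ℕ} {r : ℝ} {μ : Measure Ω}
    [IsProbabilityMeasure μ]
    (hN : IsPoissonProcess N r μ) (hr : 0 ≤ r) {a b : ℝ≥0} (hab : a < b) :
    ∀ᵐ ω ∂μ, N a ω < N b ω → ∃ s, a ≤ s ∧ s < b ∧ N s ω = N a ω + 1 := by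
  set x := r * ((b : ℝ) - a) with hx
  have h0 : 0 ≤ x := mul_nonneg hr (sub_nonneg.2 (by exact_mod_cast hab.le))
  set B := {ω | ¬ (N a ω < N b ω → ∃ s, a ≤ s ∧ s < b ∧ N s ω = N a ω + 1)} with hB
  change μ B = 0
  -- Cut `[a, b]` into `m + 1` equal cells. Failure forces two jumps in one cell or a jump in the
  -- last cell; the latter must be excluded because `s < b` is strict.
  have key : ∀ m : ℕ, μ.real B ≤ (x ^ 2 + x) / (m + 1 : ℝ) := by
    intro m
    let g : ℕ → ℝ≥0 := fun j => a + (b - a) * (j / (m + 1))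
    have hg0 : g 0 = a := by simp [g]
    have hgm : g (m + 1) = b := by
      have : ((m : ℝ≥0) + 1) ≠ 0 := by positivity
      simp only [g, Nat.cast_add, Nat.cast_one, div_self this, mul_one]
      exact add_tsub_cancel_of_le hab.le
    have hgmono : Monotone g := by
      intro i j hij
      have : (i : ℝ≥0) ≤ j := by exact_mod_cast hij
      simp only [g]
      gcongr
    have hgcoe : ∀ j, ((g (j + 1) : ℝ≥0) : ℝ) - g j = (b - a) / (m + 1) := by
      intro j
      simp only [g]
      push_cast [NNReal.coe_sub hab.le]
      ring
    have hglt : g m < b := by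
      have hpos : (0 : ℝ) < (b - a) / (m + 1) :=
        div_pos (sub_pos.2 (by exact_mod_cast hab)) (by positivity)
      have := hgcoe m
      rw [hgm] at this
      have h' : (g m : ℝ) < b := by linarith
      exact_mod_cast h'
    have hsub : B ⊆ (⋃ j ∈ Finset.range (m + 1), {ω | N (g j) ω + 2 ≤ N (g (j + 1)) ω}) ∪
        {ω | N (g m) ω < N (g (m + 1)) ω} := by
      intro ω hω
      by_contra hcon
      simp only [Set.mem_union, Set.mem_iUnion, Set.mem_ofPred_eq, not_or, not_exists, not_le,
        not_lt, Finset.mem_range] at hcon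
      apply hω
      intro hlt
      obtain ⟨h1, h2⟩ := hcon
      rw [hgm] at h2
      -- The first mesh point past a jump is the witness: the count there exceeds `N a ω` by less
      -- than two.
      have hex : ∃ j, N a ω < N (g j) ω := ⟨m, lt_of_lt_of_le hlt h2⟩
      classical
      have hjm : Nat.find hex ≤ m := Nat.find_min' hex (lt_of_lt_of_le hlt h2)
      have hspec := Nat.find_spec hex
      obtain ⟨k, hk⟩ : ∃ k, Nat.find hex = k + 1 := by
        apply Nat.exists_eq_succ_of_ne_zero
        intro h
        rw [h, hg0] at hspec
        exact lt_irrefl _ hspec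
      have hmin := Nat.find_min hex (m := k) (by omega)
      rw [hk] at hspec
      have := h1 k (by omega)
      refine ⟨g (k + 1), ?_, lt_of_le_of_lt (hgmono (by omega)) hglt, by omega⟩
      rw [← hg0]
      exact hgmono (by omega)
    have h2 : ∀ j, μ.real {ω | N (g j) ω + 2 ≤ N (g (j + 1)) ω} ≤ (x / (m + 1)) ^ 2 := by
      intro j
      have := hN.prob_increment_ge_two_le hr (hgmono (Nat.le_succ j))
      rw [Nat.succ_eq_add_one, hgcoe] at this
      rwa [hx, mul_div_assoc]
    have h1 : μ.real {ω | N (g m) ω < N (g (m + 1)) ω} ≤ x / (m + 1) := by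
      have := hN.prob_increment_pos_le hr (hgmono (Nat.le_succ m))
      rw [Nat.succ_eq_add_one, hgcoe] at this
      rwa [hx, mul_div_assoc]
    calc μ.real B ≤ _ := measureReal_mono hsub
      _ ≤ _ := measureReal_union_le _ _
      _ ≤ (∑ j ∈ Finset.range (m + 1), μ.real {ω | N (g j) ω + 2 ≤ N (g (j + 1)) ω}) +
          x / (m + 1) := add_le_add (measureReal_biUnion_finset_le _ _) h1
      _ ≤ (∑ j ∈ Finset.range (m + 1), (x / (m + 1)) ^ 2) + x / (m + 1) := by
          gcongr with j
          exact h2 j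
      _ = (x ^ 2 + x) / (m + 1 : ℝ) := by
          rw [Finset.sum_const, Finset.card_range, nsmul_eq_mul]
          have : (m + 1 : ℝ) ≠ 0 := by positivity
          push_cast
          field_simp
  have hlim : Tendsto (fun m : ℕ => (x ^ 2 + x) / (m + 1 : ℝ)) atTop (𝓝 0) :=
    tendsto_const_div_atTop_nhds_zero_nat (x ^ 2 + x) |>.comp (tendsto_add_atTop_nat 1) |>.congr
      (by intro m; simp)
  have h3 : μ.real B ≤ 0 := ge_of_tendsto' hlim key
  rw [← measureReal_eq_zero_iff]
  exact le_antisymm h3 measureReal_nonneg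

/-! ### Integrals of the sign path and detection of jumps -/

theorem measurable_sign_path {f : ℝ≥0 → ℕ} (hf : Monotone f) :
    Measurable fun s : ℝ => (-1 : ℝ) ^ f s.toNNReal :=
  (Measurable.of_discrete (f := fun k : ℕ => (-1 : ℝ) ^ k)).comp
    (hf.measurable.comp measurable_real_toNNReal)

theorem intervalIntegrable_sign_path {f : ℝ≥0 → ℕ} (hf : Monotone f) (a b : ℝ) :
    IntervalIntegrable (fun s : ℝ => (-1 : ℝ) ^ f s.toNNReal) volume a b :=
  intervalIntegrable_const (c := (1 : ℝ)) |>.mono_fun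
    (measurable_sign_path hf).aestronglyMeasurable
    (Eventually.of_forall fun s => by simp)

theorem abs_integral_sign_path_of_eq {f : ℝ≥0 → ℕ} (hf : Monotone f) {a b : ℝ≥0} (hab : a ≤ b)
    (h : f a = f b) : |∫ s in (a : ℝ)..b, (-1 : ℝ) ^ f s.toNNReal| = (b : ℝ) - a := by
  have hab' : (a : ℝ) ≤ b := by exact_mod_cast hab
  have : ∫ s in (a : ℝ)..b, (-1 : ℝ) ^ f s.toNNReal = ∫ s in (a : ℝ)..b, (-1 : ℝ) ^ f a := by
    apply intervalIntegral.integral_congr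
    intro s hs
    rw [Set.uIcc_of_le hab'] at hs
    have h1 : a ≤ s.toNNReal := NNReal.le_toNNReal_of_coe_le hs.1
    have h2 : s.toNNReal ≤ b := Real.toNNReal_le_iff_le_coe.2 hs.2
    have : f s.toNNReal = f a := le_antisymm (h ▸ hf h2) (hf h1)
    simp [this]
  rw [this, intervalIntegral.integral_const, smul_eq_mul, abs_mul]
  simp [abs_of_nonneg (sub_nonneg.2 hab')]

/-- By right-continuity the value `-1` at `s` persists on an interval to the right of `s`, of
positive length since `s < b`; elsewhere the integrand is at most `1`. -/
theorem integral_lt_of_value_neg_one {f : ℝ≥0 → ℕ} (hf : Monotone f)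
    (hc : ∀ t, ContinuousWithinAt f (Set.Ici t) t) {a b s : ℝ≥0} (has : a ≤ s) (hsb : s < b)
    (ε : ℝ) (hε : |ε| = 1) (h : ε * (-1 : ℝ) ^ f s = -1) :
    ∫ s in (a : ℝ)..b, ε * (-1 : ℝ) ^ f s.toNNReal < (b : ℝ) - a := by
  have hab' : (a : ℝ) ≤ b := by exact_mod_cast (has.trans hsb.le)
  have hle : ∀ x : ℝ, ε * (-1 : ℝ) ^ f x.toNNReal ≤ 1 := fun x => by
    refine (le_abs_self _).trans ?_
    rw [abs_mul, hε]
    simp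
  have hev : ∀ᶠ x in 𝓝[≥] s, f x = f s := by
    have := hc s
    rw [ContinuousWithinAt, nhds_discrete, tendsto_pure] at this
    exact this
  obtain ⟨u, hu, hus⟩ := (mem_nhdsGE_iff_exists_Ico_subset' hsb).1 hev
  have hsub : Set.Ioo (s : ℝ) (min u b : ℝ≥0) ⊆
      {x | ε * (-1 : ℝ) ^ f x.toNNReal < 1} ∩ Set.Ioc (a : ℝ) b := by
    intro x hx
    have hx0 : 0 ≤ x := s.2.trans hx.1.le
    lift x to ℝ≥0 using hx0
    have hx1 : s < x := by exact_mod_cast hx.1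
    have hx2 : x < min u b := by exact_mod_cast hx.2
    refine ⟨?_, ?_, ?_⟩
    · have : f x = f s := hus ⟨hx1.le, hx2.trans_le (min_le_left _ _)⟩
      simp only [Set.mem_ofPred_eq, Real.toNNReal_coe, this, h]
      norm_num
    · exact_mod_cast has.trans_lt hx1
    · exact_mod_cast (hx2.trans_le (min_le_right _ _)).le
  have hint : IntervalIntegrable (fun x : ℝ => ε * (-1 : ℝ) ^ f x.toNNReal) volume a b :=
    (intervalIntegrable_sign_path hf a b).const_mul ε
  have := intervalIntegral.integral_lt_integral_of_ae_le_of_measure_setOfPred_lt_ne_zero hab' hint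
    (intervalIntegrable_const (c := (1 : ℝ))) (Eventually.of_forall hle) (by
      rw [Measure.restrict_apply' measurableSet_Ioc]
      refine ne_of_gt (lt_of_lt_of_le ?_ (measure_mono hsub))
      rw [Real.volume_Ioo, ENNReal.ofReal_pos, sub_pos, NNReal.coe_lt_coe]
      exact lt_min hu hsb)
  simpa using this

/-- The sign at `s` is opposite to that at `a`, so both signs occur on sets of positive length. The
two choices `ε = ±(-1) ^ f a` bound the integral on either side. A unit increment is essential: a
path that only jumped by two would never change sign. -/
theorem abs_integral_sign_path_lt {f : ℝ≥0 → ℕ} (hf : Monotone f)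
    (hc : ∀ t, ContinuousWithinAt f (Set.Ici t) t) {a b s : ℝ≥0} (has : a ≤ s) (hsb : s < b)
    (h : f s = f a + 1) : |∫ s in (a : ℝ)..b, (-1 : ℝ) ^ f s.toNNReal| < (b : ℝ) - a := by
  have hsq : ((-1 : ℝ) ^ f a) * (-1) ^ f a = 1 := by
    rw [← pow_add, ← two_mul, pow_mul]; simp
  have h1 := integral_lt_of_value_neg_one hf hc has hsb ((-1) ^ f a) (by simp)
    (by rw [h, pow_succ]; linear_combination -hsq)
  have h2 := integral_lt_of_value_neg_one hf hc le_rfl (has.trans_lt hsb) (-(-1) ^ f a) (by simp)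
    (by linear_combination -hsq)
  rw [intervalIntegral.integral_const_mul] at h1 h2
  set I := ∫ s in (a : ℝ)..b, (-1 : ℝ) ^ f s.toNNReal
  rcases neg_one_pow_eq_or ℝ (f a) with h | h <;> rw [h] at h1 h2 <;> rw [abs_lt] <;>
    constructor <;> linarith

omit mΩ in
theorem increment_position (V₀ : Ω → ℝ) {N : ℝ≥0 → Ω → ℕ} (Δ : ℝ) (i : ℕ) (ω : Ω)
    (hN : Monotone fun t => N t ω) :
    increment (position V₀ N) Δ i ω =
      V₀ ω * ∫ s in (((i : ℝ) - 1) * Δ)..(i * Δ), (-1 : ℝ) ^ N s.toNNReal ω := by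
  have := intervalIntegral.integral_interval_sub_left
    (intervalIntegrable_sign_path hN 0 (i * Δ)) (intervalIntegrable_sign_path hN 0 ((i - 1) * Δ))
  rw [increment, position, position, ← mul_sub, this]

/-- Almost surely, an increment of the telegraph process is shorter than `v * Δ` exactly when the
Poisson process jumps. -/
theorem IsTelegraph.ae_abs_increment_lt_iff {v : ℝ} (hv : 0 < v) {V₀ : Ω → ℝ} {N : ℝ≥0 → Ω → ℕ}
    {r : ℝ} (hr : 0 ≤ r) {μ : Measure Ω} [IsProbabilityMeasure μ] (h : IsTelegraph v V₀ N r μ)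
    {Δ : ℝ} (hΔ : 0 < Δ) :
    ∀ᵐ ω ∂μ, ∀ i : ℕ, |increment (position V₀ N) Δ (i + 1) ω| < v * Δ ↔
      N (i * Δ.toNNReal) ω < N ((i + 1 : ℕ) * Δ.toNNReal) ω := by
  have hV : ∀ᵐ ω ∂μ, |V₀ ω| = v := by
    have hm := h.measurable_velocity
    have h1 : μ ({ω | V₀ ω = v} ∪ {ω | V₀ ω = -v}) = 1 := by
      rw [measure_union, h.prob_pos, h.prob_neg, ENNReal.add_halves]
      · rw [Set.disjoint_left]
        intro ω h1 h2
        simp only [Set.mem_ofPred_eq] at h1 h2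
        linarith
      · exact measurableSet_eq_fun hm measurable_const
    have h2 : ∀ᵐ ω ∂μ, ω ∈ ({ω | V₀ ω = v} ∪ {ω | V₀ ω = -v}) := by
      rw [← prob_compl_eq_zero_iff
        ((measurableSet_eq_fun hm measurable_const).union
          (measurableSet_eq_fun hm measurable_const))] at h1
      exact h1
    filter_upwards [h2] with ω hω
    rcases hω with hω | hω <;> simp only [Set.mem_ofPred_eq] at hω <;> rw [hω]
    · exact abs_of_pos hv
    · rw [abs_neg, abs_of_pos hv]
  have hlt : ∀ i : ℕ, (i : ℝ≥0) * Δ.toNNReal < (i + 1 : ℕ) * Δ.toNNReal := fun i => by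
    have : 0 < Δ.toNNReal := Real.toNNReal_pos.2 hΔ
    gcongr
    simp
  have hall := ae_all_iff.2 fun i : ℕ => h.poisson.ae_exists_unit_increment hr (hlt i)
  filter_upwards [hV, hall] with ω hVω hω i
  have hmono := h.poisson.mono ω
  set a : ℝ≥0 := i * Δ.toNNReal with ha
  set b : ℝ≥0 := (i + 1 : ℕ) * Δ.toNNReal with hb
  have hca : (((i + 1 : ℕ) : ℝ) - 1) * Δ = a := by
    rw [ha]; push_cast; rw [Real.coe_toNNReal _ hΔ.le]; ring
  have hcb : ((i + 1 : ℕ) : ℝ) * Δ = b := by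
    rw [hb]; push_cast; rw [Real.coe_toNNReal _ hΔ.le]
  have hba : (b : ℝ) - a = Δ := by rw [← hca, ← hcb]; ring
  rw [increment_position V₀ Δ (i + 1) ω hmono, abs_mul, hVω, mul_lt_mul_iff_right₀ hv, hca, hcb,
    ← hba]
  constructor
  · intro hlt'
    refine lt_of_le_of_ne (hmono (hlt i).le) fun heq => ?_
    exact hlt'.ne (abs_integral_sign_path_of_eq hmono (hlt i).le heq)
  · intro hN
    obtain ⟨s, h1, h2, h3⟩ := hω i hN
    exact abs_integral_sign_path_lt hmono (h.poisson.rightCont ω) h1 h2 h3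

/-! ### Measurability with respect to the observed data -/

/-- A right-continuous process with values in a countable discrete space is jointly measurable. -/
theorem measurable_uncurry_of_rightCont {Y : ℝ → Ω → ℕ} (hY : ∀ s, Measurable (Y s))
    (hc : ∀ ω s, ContinuousWithinAt (fun u => Y u ω) (Set.Ici s) s) :
    Measurable fun p : ℝ × Ω => (Y p.1 p.2 : ℝ) := by
  -- `g k s` is the first point of the grid of mesh `1 / (k + 1)` strictly right of `s`. It takes
  -- countably many values, so the process sampled along it is jointly measurable, and it approaches
  -- `s` from the side where paths are continuous.
  let g : ℕ → ℝ → ℝ := fun k s => (((⌊s * ((k : ℝ) + 1)⌋ : ℤ) : ℝ) + 1) / ((k : ℝ) + 1)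
  have hg : ∀ s, Tendsto (fun k => g k s) atTop (𝓝[≥] s) := by
    intro s
    have hlow : ∀ k, s ≤ g k s := fun k => by
      rw [le_div_iff₀ (by positivity)]
      exact (Int.lt_floor_add_one _).le
    have hup : ∀ k, g k s ≤ s + 1 / ((k : ℝ) + 1) := fun k => by
      rw [div_le_iff₀ (by positivity), add_mul, one_div, inv_mul_cancel₀ (by positivity)]
      gcongr
      exact Int.floor_le _
    refine tendsto_nhdsWithin_of_tendsto_nhds_of_eventually_within _ ?_
      (Eventually.of_forall hlow)
    refine tendsto_of_tendsto_of_tendsto_of_le_of_le tendsto_const_nhds ?_ hlow hup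
    simpa using (tendsto_const_nhds (x := s)).add (tendsto_one_div_add_atTop_nhds_zero_nat (𝕜 := ℝ))
  refine measurable_of_tendsto_metrizable (f := fun (k : ℕ) (p : ℝ × Ω) => (Y (g k p.1) p.2 : ℝ))
    (fun k => ?_) ?_
  · have h1 : Measurable fun q : ℤ × Ω => (Y (((q.1 : ℝ) + 1) / ((k : ℝ) + 1)) q.2 : ℝ) :=
      measurable_from_prod_countable_right fun j =>
        (Measurable.of_discrete (f := fun k : ℕ => (k : ℝ))).comp (hY ((j + 1 : ℝ) / (k + 1)))
    have h2 : Measurable fun p : ℝ × Ω => (⌊p.1 * ((k : ℝ) + 1)⌋, p.2) :=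
      (Int.measurable_floor.comp (measurable_fst.mul_const ((k : ℝ) + 1))).prodMk measurable_snd
    have h3 := h1.comp h2
    simp only [Function.comp_def] at h3
    exact h3
  · rw [tendsto_pi_nhds]
    rintro ⟨s, ω⟩
    have h1 := (hc ω s).tendsto.comp (hg s)
    exact (continuous_of_discreteTopology (f := fun k : ℕ => (k : ℝ))).continuousAt.tendsto.comp h1

/-- Only times up to `t` are assumed measurable, so that the lemma applies to the σ-algebra
`observed`. Stopping the process at `t` leaves the integral unchanged and makes every time
admissible. -/
theorem measurable_integral_sign {N : ℝ≥0 → Ω → ℕ} {t : ℝ≥0} (hN : ∀ s ≤ t, Measurable (N s))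
    (hc : ∀ ω s, ContinuousWithinAt (fun u => N u ω) (Set.Ici s) s) :
    Measurable fun ω => ∫ s in (0 : ℝ)..t, (-1 : ℝ) ^ N s.toNNReal ω := by
  have h1 : Measurable fun p : ℝ × Ω => (N (min p.1.toNNReal t) p.2 : ℝ) := by
    refine measurable_uncurry_of_rightCont (Y := fun s => N (min s.toNNReal t))
      (fun s => hN _ (min_le_right _ _)) fun ω s => ?_
    refine ContinuousWithinAt.comp (f := fun u : ℝ => min u.toNNReal t)
      (t := Set.Ici (min s.toNNReal t)) (hc ω _) ?_ ?_
    · exact (continuous_real_toNNReal.min continuous_const).continuousWithinAt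
    · intro u hu
      exact min_le_min_right t (Real.toNNReal_le_toNNReal hu)
  have h2 : Measurable fun p : ℝ × Ω => (-1 : ℝ) ^ N (min p.1.toNNReal t) p.2 := by
    have h3 : Measurable fun x : ℝ => (-1 : ℝ) ^ ⌊x⌋₊ :=
      (Measurable.of_discrete (f := fun k : ℕ => (-1 : ℝ) ^ k)).comp Nat.measurable_floor
    convert! h3.comp h1 using 2 with p
    simp
  have h4 : (fun ω => ∫ s in (0 : ℝ)..t, (-1 : ℝ) ^ N s.toNNReal ω) =
      fun ω => ∫ s in Set.Ioc (0 : ℝ) t, (-1 : ℝ) ^ N (min s.toNNReal t) ω := by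
    ext ω
    rw [intervalIntegral.integral_of_le t.coe_nonneg]
    refine setIntegral_congr_fun measurableSet_Ioc fun s hs => ?_
    rw [min_eq_left (Real.toNNReal_le_iff_le_coe.2 hs.2)]
  rw [h4]
  exact (h2.stronglyMeasurable.integral_prod_left'
    (μ := volume.restrict (Set.Ioc (0 : ℝ) t))).measurable

theorem observed_le {V₀ : Ω → ℝ} {N : ℝ≥0 → Ω → ℕ} (hV : Measurable V₀)
    (hN : ∀ t, Measurable (N t)) (T : ℝ) : observed V₀ N T ≤ mΩ :=
  sup_le hV.comap_le (iSup_le fun s => (hN s).comap_le)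

omit mΩ in
theorem measurable_observed_velocity (V₀ : Ω → ℝ) (N : ℝ≥0 → Ω → ℕ) (T : ℝ) :
    Measurable[observed V₀ N T] V₀ :=
  measurable_iff_comap_le.2 le_sup_left

omit mΩ in
theorem measurable_observed_count (V₀ : Ω → ℝ) (N : ℝ≥0 → Ω → ℕ) {T : ℝ} {s : ℝ≥0}
    (hs : (s : ℝ) ≤ T) : Measurable[observed V₀ N T] (N s) :=
  measurable_iff_comap_le.2 ((le_iSup (fun s : {s : ℝ≥0 // (s : ℝ) ≤ T} =>
    MeasurableSpace.comap (N s) inferInstance) ⟨s, hs⟩).trans le_sup_right)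

omit mΩ in
theorem measurable_observed_position (V₀ : Ω → ℝ) {N : ℝ≥0 → Ω → ℕ}
    (hc : ∀ ω s, ContinuousWithinAt (fun u => N u ω) (Set.Ici s) s) {t T : ℝ} (h0 : 0 ≤ t)
    (ht : t ≤ T) : Measurable[observed V₀ N T] (position V₀ N t) := by
  lift t to ℝ≥0 using h0
  have h1 := @measurable_integral_sign Ω (observed V₀ N T) N t
    (fun s hs => measurable_observed_count V₀ N ((NNReal.coe_le_coe.2 hs).trans ht)) hc
  let := observed V₀ N T
  exact (measurable_observed_velocity V₀ N T).mul h1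

omit mΩ in
theorem measurable_observed_lamHat (v : ℝ) (V₀ : Ω → ℝ) {N : ℝ≥0 → Ω → ℕ}
    (hc : ∀ ω s, ContinuousWithinAt (fun u => N u ω) (Set.Ici s) s) {Δ : ℝ} (hΔ : 0 ≤ Δ) (n : ℕ) :
    Measurable[observed V₀ N (n * Δ)] (lamHat v (position V₀ N) Δ n) := by
  let := observed V₀ N (n * Δ)
  have hinc : ∀ i ∈ Finset.Icc 1 n, Measurable (increment (position V₀ N) Δ i) := by
    intro i hi
    rw [Finset.mem_Icc] at hi
    have h1 : (1 : ℝ) ≤ i := by exact_mod_cast hi.1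
    have h2 : (i : ℝ) ≤ n := by exact_mod_cast hi.2
    refine (measurable_observed_position V₀ hc (by positivity) (by gcongr)).sub
      (measurable_observed_position V₀ hc (mul_nonneg (by linarith) hΔ) ?_)
    gcongr
    linarith
  have htil : Measurable (lamTilde v (position V₀ N) Δ n) := by
    refine Measurable.const_mul (Finset.measurable_fun_sum _ fun i hi => ?_) _
    refine Measurable.ite ?_ measurable_const measurable_const
    exact measurableSet_lt (measurable_norm.comp (hinc i hi)) measurable_const
  exact (Real.measurable_log.comp (measurable_const.sub (htil.const_mul Δ))).const_mul _

/-! ### Convergence in distribution under varying measures -/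

/-- Lévy's continuity theorem; the measure varies with `n` because the local parameters do. -/
theorem tendstoInDistribution_iff_charFun {μ : ℕ → Measure Ω} [∀ n, IsProbabilityMeasure (μ n)]
    {L : Measure ℝ} [IsProbabilityMeasure L] {X : ℕ → Ω → ℝ} (hX : ∀ n, AEMeasurable (X n) (μ n)) :
    TendstoInDistribution X atTop (id : ℝ → ℝ) μ L ↔
      ∀ t, Tendsto (fun n => charFun ((μ n).map (X n)) t) atTop (𝓝 (charFun L t)) := by
  constructor
  · intro h t
    have := ProbabilityMeasure.tendsto_iff_tendsto_charFun.1 h.tendsto t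
    simpa only [ProbabilityMeasure.coe_mk, Measure.map_id] using this
  · intro h
    refine ⟨hX, aemeasurable_id, ProbabilityMeasure.tendsto_iff_tendsto_charFun.2 fun t => ?_⟩
    simpa only [ProbabilityMeasure.coe_mk, Measure.map_id] using h t

theorem norm_cexp_sub_cexp_le (a b : ℝ) :
    ‖Complex.exp (a * Complex.I) - Complex.exp (b * Complex.I)‖ ≤ |a - b| := by
  have h : Complex.exp (a * Complex.I) - Complex.exp (b * Complex.I) =
      Complex.exp (b * Complex.I) * (Complex.exp (Complex.I * (a - b : ℝ)) - 1) := by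
    rw [mul_sub, ← Complex.exp_add]
    push_cast
    ring_nf
  rw [h, norm_mul, Complex.norm_exp_ofReal_mul_I, one_mul]
  exact Real.norm_exp_I_mul_ofReal_sub_one_le

/-- The two exponentials differ by at most `|t| * ε` where the variables are `ε`-close, and by at
most `2` everywhere. -/
theorem norm_charFun_map_sub_le {μ : Measure Ω} [IsProbabilityMeasure μ] {X Y : Ω → ℝ}
    (hX : AEMeasurable X μ) (hY : AEMeasurable Y μ) (t : ℝ) {ε : ℝ} (hε : 0 ≤ ε) :
    ‖charFun (μ.map Y) t - charFun (μ.map X) t‖ ≤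
      |t| * ε + 2 * μ.real {ω | ε ≤ |Y ω - X ω|} := by
  have hint : ∀ {Z : Ω → ℝ}, AEMeasurable Z μ →
      Integrable (fun ω => Complex.exp ((t * Z ω : ℝ) * Complex.I)) μ := fun {Z} hZ =>
    Integrable.of_bound (C := 1) (by fun_prop)
      (Eventually.of_forall fun ω => (Complex.norm_exp_ofReal_mul_I _).le)
  have hcf : ∀ {Z : Ω → ℝ}, AEMeasurable Z μ →
      charFun (μ.map Z) t = ∫ ω, Complex.exp ((t * Z ω : ℝ) * Complex.I) ∂μ := fun {Z} hZ => by
    rw [charFun_apply_real, integral_map hZ (by fun_prop)]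
    push_cast
    rfl
  have hS : NullMeasurableSet {ω | ε ≤ |Y ω - X ω|} μ :=
    nullMeasurableSet_le aemeasurable_const (by fun_prop)
  set S := {ω | ε ≤ |Y ω - X ω|}
  have hpt : ∀ ω, ‖Complex.exp ((t * Y ω : ℝ) * Complex.I) -
      Complex.exp ((t * X ω : ℝ) * Complex.I)‖ ≤ |t| * ε + S.indicator (fun _ => (2 : ℝ)) ω := by
    intro ω
    by_cases h : ω ∈ S
    · rw [Set.indicator_of_mem h]
      have := norm_sub_le (Complex.exp ((t * Y ω : ℝ) * Complex.I))
        (Complex.exp ((t * X ω : ℝ) * Complex.I))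
      rw [Complex.norm_exp_ofReal_mul_I, Complex.norm_exp_ofReal_mul_I] at this
      have := mul_nonneg (abs_nonneg t) hε
      linarith
    · rw [Set.indicator_of_notMem h, add_zero]
      refine (norm_cexp_sub_cexp_le _ _).trans ?_
      rw [← mul_sub, abs_mul]
      exact mul_le_mul_of_nonneg_left (not_le.1 h).le (abs_nonneg t)
  have hind : Integrable (S.indicator fun _ => (2 : ℝ)) μ :=
    (integrable_const (2 : ℝ)).indicator₀ hS
  rw [hcf hX, hcf hY, ← integral_sub (hint hY) (hint hX)]
  calc _ ≤ ∫ ω, |t| * ε + S.indicator (fun _ => (2 : ℝ)) ω ∂μ :=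
        norm_integral_le_of_norm_le ((integrable_const _).add hind) (Eventually.of_forall hpt)
    _ = |t| * ε + 2 * μ.real S := by
        rw [integral_add (integrable_const _) hind, integral_indicator₀ hS]
        simp [mul_comm]

/-- Slutsky's lemma for random variables defined under varying probability measures. -/
theorem tendstoInDistribution_of_tendsto_measure_sub {μ : ℕ → Measure Ω}
    [∀ n, IsProbabilityMeasure (μ n)] {L : Measure ℝ} [IsProbabilityMeasure L] {X Y : ℕ → Ω → ℝ}
    (hX : TendstoInDistribution X atTop (id : ℝ → ℝ) μ L) (hY : ∀ n, AEMeasurable (Y n) (μ n))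
    (h : ∀ ε > 0, Tendsto (fun n => (μ n).real {ω | ε ≤ |Y n ω - X n ω|}) atTop (𝓝 0)) :
    TendstoInDistribution Y atTop (id : ℝ → ℝ) μ L := by
  have hXm := hX.forall_aemeasurable
  rw [tendstoInDistribution_iff_charFun hY]
  rw [tendstoInDistribution_iff_charFun hXm] at hX
  intro t
  have hd : Tendsto (fun n => charFun ((μ n).map (Y n)) t - charFun ((μ n).map (X n)) t) atTop
      (𝓝 0) := by
    rw [tendsto_zero_iff_norm_tendsto_zero, Metric.tendsto_atTop']
    intro δ hδ
    -- This choice makes `|t| * ε ≤ δ / 2`, while twice a probability below `δ / 4` accounts for the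
    -- other half.
    have hε : 0 < δ / (2 * (|t| + 1)) := by positivity
    have h1 := (h _ hε).eventually_lt_const (show (0 : ℝ) < δ / 4 by positivity)
    obtain ⟨n₀, hn₀⟩ := eventually_atTop.1 h1
    refine ⟨n₀, fun n hn => ?_⟩
    have h2 := norm_charFun_map_sub_le (hXm n) (hY n) t hε.le
    have h3 := hn₀ n hn.le
    have h4 : |t| * (δ / (2 * (|t| + 1))) ≤ δ / 2 := by
      rw [mul_div_assoc', div_le_div_iff₀ (by positivity) (by positivity)]
      nlinarith [abs_nonneg t]
    rw [dist_zero_right, norm_norm]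
    linarith
  simpa using hd.add (hX t)

/-- Tightness: a fixed closed tail `{k ≤ |x|}` has small limit mass, the portmanteau theorem
transfers this to large `n`, and eventually `k ≤ m n`. -/
theorem tendsto_measure_ge_of_tendstoInDistribution {μ : ℕ → Measure Ω}
    [∀ n, IsProbabilityMeasure (μ n)] {L : Measure ℝ} [IsProbabilityMeasure L] {X : ℕ → Ω → ℝ}
    (hX : TendstoInDistribution X atTop (id : ℝ → ℝ) μ L) {m : ℕ → ℝ} (hm : Tendsto m atTop atTop) :
    Tendsto (fun n => μ n {ω | m n ≤ |X n ω|}) atTop (𝓝 0) := by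
  have hL : Tendsto (fun k : ℕ => L {x : ℝ | (k : ℝ) ≤ |x|}) atTop (𝓝 0) := by
    have hempty : ⋂ k : ℕ, {x : ℝ | (k : ℝ) ≤ |x|} = ∅ := by
      ext x
      obtain ⟨k, hk⟩ := exists_nat_gt |x|
      simp only [Set.mem_iInter, Set.mem_ofPred_eq, Set.mem_empty_iff_false, iff_false, not_forall,
        not_le]
      exact ⟨k, hk⟩
    rw [← measure_empty (μ := L), ← hempty]
    refine tendsto_measure_iInter_atTop
      (fun k => (measurableSet_le measurable_const measurable_norm).nullMeasurableSet) ?_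
      ⟨0, measure_ne_top _ _⟩
    intro i j hij x hx
    exact (Nat.cast_le.2 hij).trans (show (j : ℝ) ≤ |x| from hx)
  rw [ENNReal.tendsto_atTop_zero]
  intro ε hε
  rcases eq_or_ne ε ⊤ with rfl | hεt
  · exact ⟨0, fun _ _ => le_top⟩
  obtain ⟨k, hk⟩ := (hL.eventually_lt_const hε).exists
  have hclosed : IsClosed {x : ℝ | (k : ℝ) ≤ |x|} := isClosed_le continuous_const continuous_abs
  have h1 := ProbabilityMeasure.limsup_measure_closed_le_of_tendsto hX.tendsto hclosed
  simp only [ProbabilityMeasure.coe_mk, Measure.map_id] at h1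
  have h2 := eventually_lt_of_limsup_lt (h1.trans_lt hk)
  obtain ⟨n₀, hn₀⟩ := eventually_atTop.1 (h2.and (hm.eventually_ge_atTop (k : ℝ)))
  refine ⟨n₀, fun n hn => ?_⟩
  obtain ⟨h3, h4⟩ := hn₀ n hn
  rw [Measure.map_apply_of_aemeasurable (hX.forall_aemeasurable n) hclosed.measurableSet] at h3
  exact (measure_mono fun ω hω => h4.trans hω).trans h3.le

/-! ### A central limit theorem for rare events -/

theorem norm_cexp_taylor_two_le {x : ℝ} (hx : |x| ≤ 1) :
    ‖Complex.exp (x * Complex.I) - (1 + x * Complex.I - x ^ 2 / 2)‖ ≤ |x| ^ 3 := by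
  have h := Complex.exp_bound (x := x * Complex.I) (by simpa using hx) (n := 3) (by norm_num)
  have h1 : ∑ m ∈ Finset.range 3, ((x : ℂ) * Complex.I) ^ m / m.factorial =
      1 + x * Complex.I - x ^ 2 / 2 := by
    simp [Finset.sum_range_succ, mul_pow]
    ring
  rw [h1] at h
  refine h.trans ?_
  have h2 : ‖(x : ℂ) * Complex.I‖ = |x| := by simp
  rw [h2]
  have : 0 ≤ |x| ^ 3 := by positivity
  norm_num [Nat.factorial]
  linarith

/-- Centering cancels the linear Taylor terms and leaves the variance `p * (1 - p)`. The factor `p`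
in the remainder is essential: `n * p` remainders of order `c ^ 3` are negligible when `n * p * c ^
2` is bounded, whereas `n` of them need not be. -/
theorem norm_centered_bernoulli_charFun_le {p a : ℝ} (h0 : 0 ≤ p) (h1 : p ≤ 1) (ha : |a| ≤ 1) :
    ‖((1 - p) * Complex.exp ((-(p * a) : ℝ) * Complex.I) +
        p * Complex.exp (((1 - p) * a : ℝ) * Complex.I) - 1 : ℂ) -
      (-(p * (1 - p) * a ^ 2 / 2) : ℝ)‖ ≤ p * |a| ^ 3 := by
  have e1 := norm_cexp_taylor_two_le (x := -(p * a)) (by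
    rw [abs_neg, abs_mul, abs_of_nonneg h0]; nlinarith [abs_nonneg a])
  have e2 := norm_cexp_taylor_two_le (x := (1 - p) * a) (by
    rw [abs_mul, abs_of_nonneg (sub_nonneg.2 h1)]; nlinarith [abs_nonneg a])
  set E1 := Complex.exp ((-(p * a) : ℝ) * Complex.I)
  set E2 := Complex.exp (((1 - p) * a : ℝ) * Complex.I)
  have hsplit : ((1 - p) * E1 + p * E2 - 1 : ℂ) - (-(p * (1 - p) * a ^ 2 / 2) : ℝ) =
      ((1 - p : ℝ) : ℂ) * (E1 - (1 + (-(p * a) : ℝ) * Complex.I - (-(p * a) : ℝ) ^ 2 / 2)) +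
      (p : ℂ) * (E2 - (1 + ((1 - p) * a : ℝ) * Complex.I - ((1 - p) * a : ℝ) ^ 2 / 2)) := by
    push_cast
    ring
  rw [hsplit]
  refine (norm_add_le _ _).trans ?_
  rw [norm_mul, norm_mul, Complex.norm_real, Complex.norm_real, Real.norm_eq_abs, Real.norm_eq_abs,
    abs_of_nonneg h0, abs_of_nonneg (sub_nonneg.2 h1)]
  rw [abs_neg, abs_mul, abs_of_nonneg h0, mul_pow] at e1
  rw [abs_mul, abs_of_nonneg (sub_nonneg.2 h1), mul_pow] at e2
  have hA : 0 ≤ |a| ^ 3 := by positivity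
  have hq := sub_nonneg.2 h1
  calc _ ≤ (1 - p) * (p ^ 3 * |a| ^ 3) + p * ((1 - p) ^ 3 * |a| ^ 3) := by gcongr
    _ = (p * |a| ^ 3) * ((1 - p) * (p ^ 2 + (1 - p) ^ 2)) := by ring
    _ ≤ (p * |a| ^ 3) * 1 := by
        gcongr
        nlinarith [mul_nonneg h0 hq, mul_nonneg (mul_nonneg h0 hq) hq]
    _ = _ := mul_one _

/-- The characteristic function of a centered Bernoulli variable. -/
theorem charFun_map_indicator_sub {μ : Measure Ω} [IsProbabilityMeasure μ] {A : Set Ω}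
    (hA : MeasurableSet A) (a : ℝ) :
    charFun (μ.map fun ω => A.indicator (fun _ => (1 : ℝ)) ω - μ.real A) a =
      (1 - μ.real A) * Complex.exp ((-(μ.real A * a) : ℝ) * Complex.I) +
        μ.real A * Complex.exp (((1 - μ.real A) * a : ℝ) * Complex.I) := by
  set p := μ.real A
  have hm : Measurable fun ω => A.indicator (fun _ => (1 : ℝ)) ω - p :=
    (measurable_const.indicator hA).sub_const p
  rw [charFun_apply_real, integral_map hm.aemeasurable (by fun_prop)]
  set E1 := Complex.exp ((-(p * a) : ℝ) * Complex.I) with hE1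
  set E2 := Complex.exp (((1 - p) * a : ℝ) * Complex.I) with hE2
  have hpt : ∀ ω, Complex.exp (a * ((A.indicator (fun _ => (1 : ℝ)) ω - p : ℝ) : ℂ) * Complex.I) =
      E1 + A.indicator (fun _ => E2 - E1) ω := by
    intro ω
    by_cases h : ω ∈ A
    · rw [Set.indicator_of_mem h, Set.indicator_of_mem h, hE1, hE2]
      push_cast
      ring_nf
    · rw [Set.indicator_of_notMem h, Set.indicator_of_notMem h, hE1]
      push_cast
      ring_nf
  simp_rw [hpt]
  rw [integral_add (integrable_const _) ((integrable_const _).indicator hA),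
    integral_indicator_const _ hA]
  simp only [integral_const, probReal_univ, one_smul, Complex.real_smul]
  ring

/-- A central limit theorem for triangular arrays of independent events: if the `n` events of the
`n`-th row have probability `p n → 0` and `n * p n * c n ^ 2 → σ²` with `c n → 0`, then the centered
number of events, multiplied by `c n`, converges in distribution to a normal variable. -/
theorem tendstoInDistribution_sum_indicator {μ : ℕ → Measure Ω} [∀ n, IsProbabilityMeasure (μ n)]
    {A : ℕ → ℕ → Set Ω} (hA : ∀ n i, MeasurableSet (A n i))
    (hind : ∀ n, iIndepSet (A n) (μ n)) {p c : ℕ → ℝ} (hp : ∀ n i, (μ n).real (A n i) = p n)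
    (hp0 : Tendsto p atTop (𝓝 0)) (hc0 : Tendsto c atTop (𝓝 0)) {σ2 : ℝ≥0}
    (hσ : Tendsto (fun n => n * p n * c n ^ 2) atTop (𝓝 σ2)) :
    TendstoInDistribution
      (fun n ω => c n * ∑ i ∈ Finset.range n, ((A n i).indicator (fun _ => (1 : ℝ)) ω - p n))
      atTop (id : ℝ → ℝ) μ (gaussianReal 0 σ2) := by
  have hm : ∀ n i, Measurable fun ω => (A n i).indicator (fun _ => (1 : ℝ)) ω - p n :=
    fun n i => (measurable_const.indicator (hA n i)).sub_const _
  have hsm : ∀ n, Measurable fun ω =>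
      ∑ i ∈ Finset.range n, ((A n i).indicator (fun _ => (1 : ℝ)) ω - p n) :=
    fun n => Finset.measurable_fun_sum _ fun i _ => hm n i
  rw [tendstoInDistribution_iff_charFun fun n => ((hsm n).const_mul _).aemeasurable]
  intro t
  -- `1 + w n` is the common characteristic function of the summands at `c n * t`, so only the limit
  -- of `n * w n` is needed.
  let w : ℕ → ℂ := fun n => (1 - p n) * Complex.exp ((-(p n * (c n * t)) : ℝ) * Complex.I) +
        p n * Complex.exp (((1 - p n) * (c n * t) : ℝ) * Complex.I) - 1
  have hcf : ∀ n, charFun ((μ n).map fun ω =>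
      c n * ∑ i ∈ Finset.range n, ((A n i).indicator (fun _ => (1 : ℝ)) ω - p n)) t =
      (1 + w n) ^ n := by
    intro n
    have hI : iIndepFun (fun i ω => (A n i).indicator (fun _ => (1 : ℝ)) ω - p n) (μ n) :=
      (hind n).iIndepFun_indicator.comp (fun _ x => x - p n) (fun _ => by fun_prop)
    rw [charFun_map_mul_comp (hsm n).aemeasurable,
      (hI.restrict _).charFun_map_fun_finsetSum_eq_prod (fun i _ => (hm n i).aemeasurable),
      Finset.prod_apply]
    have : ∀ i, charFun ((μ n).map fun ω => (A n i).indicator (fun _ => (1 : ℝ)) ω - p n)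
        (c n * t) = 1 + w n := by
      intro i
      have := charFun_map_indicator_sub (μ := μ n) (hA n i) (c n * t)
      rw [hp] at this
      rw [this]
      simp only [w]
      ring
    simp only [this, Finset.prod_const, Finset.card_range]
  simp_rw [hcf]
  rw [charFun_gaussianReal]
  refine Complex.tendsto_one_add_pow_exp_of_tendsto ?_
  have hp01 : ∀ n, 0 ≤ p n ∧ p n ≤ 1 := fun n => by
    rw [← hp n 0]
    exact ⟨measureReal_nonneg, measureReal_le_one⟩
  have hct : Tendsto (fun n => c n * t) atTop (𝓝 0) := by simpa using hc0.mul_const t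
  have hmain : Tendsto (fun n : ℕ => (((n * p n * c n ^ 2) * (-((1 - p n) * t ^ 2 / 2)) : ℝ) : ℂ))
      atTop (𝓝 (((t : ℂ) * ((0 : ℝ) : ℂ) * Complex.I - ((σ2 : ℝ) : ℂ) * (t : ℂ) ^ 2 / 2))) := by
    have h1 : Tendsto (fun n : ℕ => (n * p n * c n ^ 2) * (-((1 - p n) * t ^ 2 / 2))) atTop
        (𝓝 (σ2 * (-((1 - 0) * t ^ 2 / 2)))) :=
      hσ.mul ((((tendsto_const_nhds.sub hp0).mul_const _).div_const _).neg)
    have h2 := (Complex.continuous_ofReal.tendsto _).comp h1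
    convert! h2 using 2
    push_cast
    ring
  have herr : Tendsto (fun n : ℕ => (n : ℂ) * w n -
      (((n * p n * c n ^ 2) * (-((1 - p n) * t ^ 2 / 2)) : ℝ) : ℂ)) atTop (𝓝 0) := by
    rw [tendsto_zero_iff_norm_tendsto_zero]
    have hb : Tendsto (fun n : ℕ => (n * p n * c n ^ 2) * t ^ 2 * |c n * t|) atTop (𝓝 0) := by
      have := (hσ.mul_const (t ^ 2)).mul hct.abs
      simpa using this
    refine squeeze_zero' (Eventually.of_forall fun n => norm_nonneg _) ?_ hb
    have hsmall : ∀ᶠ n in atTop, |c n * t| ≤ 1 := by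
      have := hct.abs
      rw [abs_zero] at this
      exact this.eventually_le_const one_pos
    filter_upwards [hsmall] with n hn
    have h1 := norm_centered_bernoulli_charFun_le (hp01 n).1 (hp01 n).2 hn
    have h2 : (n : ℂ) * w n - (((n * p n * c n ^ 2) * (-((1 - p n) * t ^ 2 / 2)) : ℝ) : ℂ) =
        (n : ℂ) * (w n - (-(p n * (1 - p n) * (c n * t) ^ 2 / 2) : ℝ)) := by
      push_cast
      ring
    rw [h2, norm_mul, Complex.norm_natCast]
    calc (n : ℝ) * _ ≤ n * (p n * |c n * t| ^ 3) := by gcongr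
      _ = n * (p n * (|c n * t| ^ 2 * |c n * t|)) := by ring
      _ = _ := by rw [sq_abs]; ring
  simpa using herr.add hmain

/-! ### Linearization and asymptotic normality of the estimator -/

/-- Linearization of `√T * (-(1 / Δ) * log (1 - k) - θ)` in `k` at `1 - exp (-(θ * Δ))`. -/
theorem abs_sqrt_mul_log_sub_linear_le {T Δ θ k q l : ℝ} (hΔ : 0 < Δ) (hT : 0 < T)
    (hq : q = √T / (2 * Δ))
    (hl : l = √T / Δ * ((k - (1 - Real.exp (-(θ * Δ)))) / Real.exp (-(θ * Δ)))) (hlq : |l| < q) :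
    |√T * (-(1 / Δ) * Real.log (1 - k) - θ) - l| ≤ l ^ 2 / q := by
  have hsT : 0 < √T := Real.sqrt_pos.2 hT
  have he : 0 < Real.exp (-(θ * Δ)) := Real.exp_pos _
  set e := Real.exp (-(θ * Δ)) with hedef
  set u := (k - (1 - e)) / e with hu
  have hq0 : 0 < q := by rw [hq]; positivity
  -- With `1 - k = e * (1 - u)`, the expression is `-2q * log (1 - u)`, with linear part `l = 2q *
  -- u`. The hypothesis `|l| < q` means `|u| < 1 / 2`, which bounds the remainder by `2q * 2u ^ 2 =
  -- l ^ 2 / q` and keeps the default value `log 0` out of play.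
  have hlu : l = 2 * q * u := by rw [hl, hq]; field_simp
  have hu2 : |u| < 1 / 2 := by
    rw [hlu, abs_mul, abs_of_pos (by positivity : 0 < 2 * q)] at hlq
    nlinarith
  have h1k : 1 - k = e * (1 - u) := by rw [hu]; field_simp; ring
  have h1u : 0 < 1 - u := by linarith [(abs_lt.1 hu2).2]
  have hlog : Real.log (1 - k) = -(θ * Δ) + Real.log (1 - u) := by
    rw [h1k, Real.log_mul he.ne' h1u.ne', hedef, Real.log_exp]
  have hY : √T * (-(1 / Δ) * Real.log (1 - k) - θ) - l =
      -(2 * q) * (u + Real.log (1 - u)) := by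
    rw [hlog, hlu, hq]; field_simp; ring
  have h2 := Real.abs_log_sub_add_sum_range_le (hu2.trans (by norm_num)) 1
  simp only [Finset.range_one, Finset.sum_singleton, zero_add, pow_one, Nat.cast_zero, div_one,
    one_add_one_eq_two] at h2
  have h3 : |u| ^ 2 / (1 - |u|) ≤ 2 * u ^ 2 := by
    rw [sq_abs, div_le_iff₀ (by linarith)]
    nlinarith [sq_nonneg u]
  rw [hY, abs_mul, abs_neg, abs_of_pos (by positivity : 0 < 2 * q)]
  calc 2 * q * |u + Real.log (1 - u)| ≤ 2 * q * (2 * u ^ 2) := by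
        gcongr
        exact h2.trans h3
    _ = l ^ 2 / q := by rw [hlu]; field_simp

omit mΩ in
theorem lamHat_eq {v Δ : ℝ} (hΔ : 0 < Δ) (X : ℝ → Ω → ℝ) (A : ℕ → Set Ω) (n : ℕ) (ω : Ω)
    (h : ∀ i : ℕ, |increment X Δ (i + 1) ω| < v * Δ ↔ ω ∈ A i) :
    lamHat v X Δ n ω = -(1 / Δ) *
      Real.log (1 - (∑ i ∈ Finset.range n, (A i).indicator (fun _ => (1 : ℝ)) ω) / n) := by
  classical
  have hsum : (∑ i ∈ Finset.Icc 1 n, if |increment X Δ i ω| < v * Δ then (1 : ℝ) else 0) =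
      ∑ i ∈ Finset.range n, (A i).indicator (fun _ => (1 : ℝ)) ω := by
    refine Finset.sum_nbij' (fun i => i - 1) (fun i => i + 1) ?_ ?_ ?_ ?_ ?_
    · intro i hi; simp only [Finset.mem_Icc, Finset.mem_range] at *; omega
    · intro i hi; simp only [Finset.mem_Icc, Finset.mem_range] at *; omega
    · intro i hi; simp only [Finset.mem_Icc] at *; omega
    · intro i _; simp
    · intro i hi
      obtain ⟨j, rfl⟩ : ∃ j, i = j + 1 := ⟨i - 1, by simp only [Finset.mem_Icc] at hi; omega⟩
      simp only [h j, Set.indicator_apply, Nat.add_sub_cancel]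
  have htil : Δ * lamTilde v X Δ n ω =
      (∑ i ∈ Finset.range n, (A i).indicator (fun _ => (1 : ℝ)) ω) / n := by
    rw [← hsum]
    simp only [lamTilde]
    rw [one_div, mul_inv]
    field_simp
  rw [lamHat, htil]

theorem IsPoissonProcess.iIndepSet_jump {N : ℝ≥0 → Ω → ℕ} {r : ℝ} {μ : Measure Ω}
    (hN : IsPoissonProcess N r μ) {t : ℕ → ℝ≥0} (ht : Monotone t) :
    iIndepSet (fun i : ℕ => {ω | N (t i) ω < N (t (i + 1)) ω}) μ := by
  have hI := hN.indepIncrements.nat ht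
  have hset : ∀ i, {ω | N (t i) ω < N (t (i + 1)) ω} =
      (fun ω => N (t (i + 1)) ω - N (t i) ω) ⁻¹' Set.Ioi 0 := fun i => by
    ext ω
    simp
  have hm : ∀ i, MeasurableSet {ω | N (t i) ω < N (t (i + 1)) ω} :=
    fun i => measurableSet_lt (hN.measurable _) (hN.measurable _)
  rw [iIndepSet_iff_meas_biInter hm]
  intro s
  simp_rw [hset]
  exact hI.measure_inter_preimage_eq_mul s fun i _ => MeasurableSet.of_discrete

/-- Squeezed between `θ / (1 + θ * Δ)` and `θ`, from `1 + x ≤ exp x` at `x = ±θ * Δ`. -/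
theorem tendsto_one_sub_exp_div {θ Δ : ℕ → ℝ} {θ₀ : ℝ} (hθ0 : ∀ n, 0 < θ n) (hΔ0 : ∀ n, 0 < Δ n)
    (hθ : Tendsto θ atTop (𝓝 θ₀)) (hΔ : Tendsto Δ atTop (𝓝 0)) :
    Tendsto (fun n => (1 - Real.exp (-(θ n * Δ n))) / Δ n) atTop (𝓝 θ₀) := by
  have h1 : Tendsto (fun n => θ n / (1 + θ n * Δ n)) atTop (𝓝 θ₀) := by
    have := hθ.div (tendsto_const_nhds.add (hθ.mul hΔ) : Tendsto (fun n => 1 + θ n * Δ n) atTop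
      (𝓝 (1 + θ₀ * 0))) (by simp)
    simpa [Pi.div_def] using this
  refine tendsto_of_tendsto_of_tendsto_of_le_of_le h1 hθ (fun n => ?_) fun n => ?_
  · have hx : 0 < θ n * Δ n := mul_pos (hθ0 n) (hΔ0 n)
    have h2 : Real.exp (-(θ n * Δ n)) ≤ 1 / (1 + θ n * Δ n) := by
      rw [Real.exp_neg, ← one_div]
      gcongr
      linarith [Real.add_one_le_exp (θ n * Δ n)]
    simp only
    rw [div_le_div_iff₀ (by positivity) (hΔ0 n)]
    rw [le_div_iff₀ (by positivity)] at h2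
    linarith
  · simp only
    rw [div_le_iff₀ (hΔ0 n)]
    linarith [Real.add_one_le_exp (-(θ n * Δ n))]

/-- The moving parameter serves two purposes: a constant sequence gives asymptotic normality, and
`θ₀ + h / √T` gives regularity. -/
theorem tendstoInDistribution_lamHat {P : Set.Ioi (0 : ℝ) → Measure Ω}
    [∀ θ, IsProbabilityMeasure (P θ)] {v : ℝ} (hv : 0 < v) {V₀ : Ω → ℝ} {N : ℝ≥0 → Ω → ℕ}
    (hX : ∀ θ : Set.Ioi (0 : ℝ), IsTelegraph v V₀ N θ (P θ))
    {Δ : ℕ → ℝ} (hΔ0 : ∀ n, 0 < Δ n) (hΔ : Tendsto Δ atTop (𝓝 0))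
    (hnΔ : Tendsto (fun n : ℕ => n * Δ n) atTop atTop) {θ₀ : Set.Ioi (0 : ℝ)}
    {θ : ℕ → Set.Ioi (0 : ℝ)} (hθ : Tendsto (fun n => (θ n : ℝ)) atTop (𝓝 θ₀)) :
    TendstoInDistribution
      (fun (n : ℕ) ω => √(n * Δ n) * (lamHat v (position V₀ N) (Δ n) n ω - θ n))
      atTop (id : ℝ → ℝ) (fun n => P (θ n)) (gaussianReal 0 (θ₀ : ℝ).toNNReal) := by
  have hθ0 : ∀ n, (0 : ℝ) < θ n := fun n => (θ n).2
  let t : ℕ → ℕ → ℝ≥0 := fun n i => i * (Δ n).toNNReal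
  have ht : ∀ n, Monotone (t n) := fun n i j hij => by
    have : (i : ℝ≥0) ≤ j := by exact_mod_cast hij
    simp only [t]
    gcongr
  let A : ℕ → ℕ → Set Ω := fun n i => {ω | N (t n i) ω < N (t n (i + 1)) ω}
  let p : ℕ → ℝ := fun n => 1 - Real.exp (-(θ n * Δ n))
  let T : ℕ → ℝ := fun n => n * Δ n
  -- Chosen so that `c n` times the centered count is the linear part `√T / Δ * (k - p) / (1 - p)`,
  -- with `k` the empirical frequency; then `n * p * c ^ 2 = (p / Δ) / (1 - p) ^ 2` for `T n > 0`.
  let c : ℕ → ℝ := fun n => √(T n) / (T n * (1 - p n))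
  have hp1 : ∀ n, 1 - p n = Real.exp (-(θ n * Δ n)) := fun n => by simp [p]
  have hA : ∀ n i, MeasurableSet (A n i) := fun n i =>
    measurableSet_lt ((hX (θ n)).poisson.measurable _) ((hX (θ n)).poisson.measurable _)
  have hp : ∀ n i, (P (θ n)).real (A n i) = p n := by
    intro n i
    rw [(hX (θ n)).poisson.prob_increment_pos (hθ0 n).le (ht n (Nat.le_succ i))]
    simp only [p, t]
    push_cast
    rw [Real.coe_toNNReal _ (hΔ0 n).le]
    ring_nf
  have hpΔ : Tendsto (fun n => p n / Δ n) atTop (𝓝 θ₀) := tendsto_one_sub_exp_div hθ0 hΔ0 hθ hΔ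
  have hp0 : Tendsto p atTop (𝓝 0) := by
    have := hpΔ.mul hΔ
    rw [mul_zero] at this
    exact this.congr fun n => div_mul_cancel₀ _ (hΔ0 n).ne'
  have h1p : Tendsto (fun n => 1 - p n) atTop (𝓝 1) := by
    simpa using (tendsto_const_nhds (x := (1 : ℝ))).sub hp0
  have hsT : Tendsto (fun n => √(T n)) atTop atTop := Real.tendsto_sqrt_atTop.comp hnΔ
  have hTpos : ∀ᶠ n in atTop, 0 < T n := hnΔ.eventually_gt_atTop 0
  have hc0 : Tendsto c atTop (𝓝 0) := by
    have h1 : Tendsto (fun n => (√(T n))⁻¹ * (1 - p n)⁻¹) atTop (𝓝 (0 * 1⁻¹)) :=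
      hsT.inv_tendsto_atTop.mul (h1p.inv₀ one_ne_zero)
    rw [zero_mul] at h1
    refine h1.congr fun n => ?_
    simp only [c]
    rw [← div_div, Real.sqrt_div_self, div_eq_mul_inv]
  have hσ : Tendsto (fun n => n * p n * c n ^ 2) atTop (𝓝 ((θ₀ : ℝ).toNNReal : ℝ)) := by
    rw [Real.coe_toNNReal _ (le_of_lt θ₀.2)]
    have h1 : Tendsto (fun n => p n / Δ n / (1 - p n) ^ 2) atTop (𝓝 ((θ₀ : ℝ) / 1 ^ 2)) :=
      hpΔ.div (h1p.pow 2) (by norm_num)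
    rw [one_pow, div_one] at h1
    refine h1.congr' ?_
    filter_upwards [hTpos] with n hn
    have hq : 1 - p n ≠ 0 := by rw [hp1]; exact (Real.exp_pos _).ne'
    have hΔn := (hΔ0 n).ne'
    have hn0 : (n : ℝ) ≠ 0 := fun h => by simp [T, h] at hn
    simp only [c]
    rw [div_pow, Real.sq_sqrt hn.le]
    simp only [T]
    field_simp
  let S : ℕ → Ω → ℝ := fun n ω => c n * ∑ i ∈ Finset.range n,
    ((A n i).indicator (fun _ => (1 : ℝ)) ω - p n)
  have hS : TendstoInDistribution S atTop (id : ℝ → ℝ) (fun n => P (θ n))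
      (gaussianReal 0 (θ₀ : ℝ).toNNReal) :=
    tendstoInDistribution_sum_indicator hA
      (fun n => (hX (θ n)).poisson.iIndepSet_jump (ht n)) hp hp0 hc0 hσ
  refine tendstoInDistribution_of_tendsto_measure_sub hS (fun n => ?_) fun ε hε => ?_
  · have h1 := (hX (θ n)).poisson
    have h2 := (measurable_observed_lamHat v V₀ h1.rightCont (hΔ0 n).le n).mono
      (observed_le (hX (θ n)).measurable_velocity h1.measurable _) le_rfl
    exact ((h2.sub_const _).const_mul _).aemeasurable
  · let q : ℕ → ℝ := fun n => √(T n) / (2 * Δ n)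
    have hq : Tendsto q atTop atTop := by
      have h1 : Tendsto (fun n => (2 * Δ n)⁻¹) atTop atTop := by
        refine Tendsto.inv_tendsto_nhdsGT_zero (tendsto_nhdsWithin_iff.2 ⟨?_, ?_⟩)
        · simpa using hΔ.const_mul 2
        · exact Eventually.of_forall fun n => mul_pos two_pos (hΔ0 n)
      exact (hsT.atTop_mul_atTop₀ h1).congr fun n => (div_eq_mul_inv _ _).symm
    -- If `|S n|` is below both bounds, the linearization applies and its error is at most `S n ^ 2
    -- / q n < ε`. As `q n → ∞` and `S n` is tight, the exceptional event is negligible.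
    have hm : Tendsto (fun n => min (q n) √(ε * q n)) atTop atTop :=
      tendsto_atTop.2 fun b => by
        filter_upwards [hq.eventually_ge_atTop b,
          (Real.tendsto_sqrt_atTop.comp (hq.const_mul_atTop hε)).eventually_ge_atTop b] with n h1 h2
        exact le_min h1 h2
    have hlim := tendsto_measure_ge_of_tendstoInDistribution hS hm
    have hlim' : Tendsto (fun n => (P (θ n)).real {ω | min (q n) √(ε * q n) ≤ |S n ω|}) atTop
        (𝓝 0) := by
      have := (ENNReal.tendsto_toReal ENNReal.zero_ne_top).comp hlim
      exact this
    refine squeeze_zero' (Eventually.of_forall fun n => measureReal_nonneg) ?_ hlim'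
    filter_upwards [hTpos] with n hn
    refine ENNReal.toReal_mono (measure_ne_top _ _) (measure_mono_ae ?_)
    filter_upwards [(hX (θ n)).ae_abs_increment_lt_iff hv (hθ0 n).le (hΔ0 n)] with ω hω hle
    change min (q n) √(ε * q n) ≤ |S n ω|
    by_contra hcon
    rw [not_le, lt_min_iff] at hcon
    have hn0 : (n : ℝ) ≠ 0 := fun h => by simp [T, h] at hn
    have hq0 : 0 < q n := (abs_nonneg _).trans_lt hcon.1
    have hhat := lamHat_eq (hΔ0 n) (position V₀ N) (A n) n ω hω
    have hbound := abs_sqrt_mul_log_sub_linear_le (T := T n) (hΔ0 n) hn (θ := θ n)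
      (k := (∑ i ∈ Finset.range n, (A n i).indicator (fun _ => (1 : ℝ)) ω) / n)
      (l := S n ω) (q := q n) rfl (by
        have h1 : S n ω = c n * ((∑ i ∈ Finset.range n, (A n i).indicator (fun _ => (1 : ℝ)) ω) -
            n * p n) := by
          simp only [S, Finset.sum_sub_distrib, Finset.sum_const, Finset.card_range, nsmul_eq_mul]
        rw [h1, ← hp1]
        have hq : 1 - p n ≠ 0 := by rw [hp1]; exact (Real.exp_pos _).ne'
        have hΔn := (hΔ0 n).ne'
        simp only [c, T]
        field_simp
        ring) hcon.1
    rw [← hhat] at hbound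
    have h3 : ε ≤ S n ω ^ 2 / q n := le_trans hle hbound
    rw [le_div_iff₀ hq0] at h3
    have h4 := Real.lt_sqrt (abs_nonneg _) |>.1 hcon.2
    rw [sq_abs] at h4
    linarith

/-! ### Likelihood ratio of the continuous-time experiment -/

/-- The density of the Poisson process of rate `a` with respect to that of rate `b` on `[0, T]`, as
a function of the number `k` of points. -/
def poissonDensity (a b T : ℝ) (k : ℕ) : ℝ := (a / b) ^ k * Real.exp (-((a - b) * T))

theorem poissonDensity_nonneg {a b : ℝ} (ha : 0 ≤ a) (hb : 0 ≤ b) (T : ℝ) (k : ℕ) :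
    0 ≤ poissonDensity a b T k := by
  unfold poissonDensity
  positivity

theorem poissonMeasure_singleton_eq {a b : ℝ} (ha : 0 ≤ a) (hb : 0 < b) {δ : ℝ} (hδ : 0 ≤ δ)
    (k : ℕ) : poissonMeasure (a * δ).toNNReal {k} =
      ENNReal.ofReal (poissonDensity a b δ k) * poissonMeasure (b * δ).toNNReal {k} := by
  rw [poissonMeasure_singleton, poissonMeasure_singleton,
    ← ENNReal.ofReal_mul (poissonDensity_nonneg ha hb.le _ _),
    Real.coe_toNNReal _ (mul_nonneg ha hδ), Real.coe_toNNReal _ (mul_nonneg hb.le hδ)]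
  congr 1
  have h1 : Real.exp (-(a * δ)) = Real.exp (-((a - b) * δ)) * Real.exp (-(b * δ)) := by
    rw [← Real.exp_add]; ring_nf
  have h2 : (a / b) ^ k * b ^ k = a ^ k := by rw [← mul_pow, div_mul_cancel₀ _ hb.ne']
  rw [h1, poissonDensity, mul_pow, mul_pow, ← h2]
  ring

/-- Multiplicativity makes the likelihood ratio independent of the grid: only the total count and
the total time enter. -/
theorem prod_poissonDensity (a b : ℝ) {m : ℕ} (δ : Fin m → ℝ) (k : Fin m → ℕ) :
    ∏ i, poissonDensity a b (δ i) (k i) = poissonDensity a b (∑ i, δ i) (∑ i, k i) := by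
  simp only [poissonDensity, Finset.prod_mul_distrib, Finset.prod_pow_eq_pow_sum, ← Real.exp_sum,
    Finset.sum_neg_distrib, Finset.mul_sum]

/-- The increments of a process along `t 0, …, t m`. -/
def increments (N : ℝ≥0 → Ω → ℕ) (t : ℕ → ℝ≥0) (m : ℕ) (ω : Ω) (i : Fin m) : ℕ :=
  N (t (i + 1)) ω - N (t i) ω

theorem IsPoissonProcess.measurable_increments {N : ℝ≥0 → Ω → ℕ} {r : ℝ} {μ : Measure Ω}
    (hN : IsPoissonProcess N r μ) (t : ℕ → ℝ≥0) (m : ℕ) : Measurable (increments N t m) :=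
  measurable_pi_lambda _ fun _ => (hN.measurable _).sub (hN.measurable _)

theorem IsPoissonProcess.map_increments {N : ℝ≥0 → Ω → ℕ} {r : ℝ} {μ : Measure Ω}
    (hN : IsPoissonProcess N r μ) {t : ℕ → ℝ≥0} (ht : Monotone t) (m : ℕ) :
    μ.map (increments N t m) =
      Measure.pi fun i : Fin m => poissonMeasure (r * ((t (i + 1) : ℝ) - t i)).toNNReal := by
  have h1 := (hN.indepIncrements.nat ht).precomp (g := fun i : Fin m => (i : ℕ)) Fin.val_injective
  have h2 := iIndepFun.map_fun_eq_pi_map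
    (f := fun (i : Fin m) ω => N (t (i + 1)) ω - N (t i) ω)
    (fun i => ((hN.measurable (t (i + 1))).sub (hN.measurable (t i))).aemeasurable) h1
  change μ.map (fun ω (i : Fin m) => N (t (i + 1)) ω - N (t i) ω) = _
  refine h2.trans ?_
  congr 1
  ext1 i
  exact (hN.law_increment (t i) (t (i + 1)) (ht (Nat.le_succ _))).map_eq

theorem IsPoissonProcess.sum_increments {N : ℝ≥0 → Ω → ℕ} {r : ℝ} {μ : Measure Ω}
    (hN : IsPoissonProcess N r μ) {t : ℕ → ℝ≥0} (ht : Monotone t) (h0 : t 0 = 0) (m : ℕ) (ω : Ω) :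
    ∑ i ∈ Finset.range m, (N (t (i + 1)) ω - N (t i) ω) = N (t m) ω := by
  have := Finset.sum_range_tsub (f := fun i => N (t i) ω) (fun i j hij => hN.mono ω (ht hij)) m
  rw [this]
  simp only [h0, hN.zero, Nat.sub_zero]

/-- Increment vectors live in a countable space and have product laws, so comparing point masses
suffices. -/
theorem IsPoissonProcess.measure_increments_preimage {N : ℝ≥0 → Ω → ℕ} {a b : ℝ} {μ ν : Measure Ω}
    (hμ : IsPoissonProcess N a μ) (hν : IsPoissonProcess N b ν) (ha : 0 ≤ a) (hb : 0 < b)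
    {t : ℕ → ℝ≥0} (ht : Monotone t) (h0 : t 0 = 0) (m : ℕ) (E : Set (Fin m → ℕ)) :
    μ (increments N t m ⁻¹' E) = ∫⁻ ω in increments N t m ⁻¹' E,
      ENNReal.ofReal (poissonDensity a b (t m) (N (t m) ω)) ∂ν := by
  have hmeas := hμ.measurable_increments t m
  have hE : MeasurableSet E := E.to_countable.measurableSet
  have hw : Measurable fun d : Fin m → ℕ =>
      ENNReal.ofReal (poissonDensity a b (t m) (∑ i, d i)) := measurable_of_countable _
  have hmap : μ.map (increments N t m) = (ν.map (increments N t m)).withDensity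
      fun d => ENNReal.ofReal (poissonDensity a b (t m) (∑ i, d i)) := by
    refine Measure.ext_of_singleton fun d => ?_
    rw [withDensity_apply _ (measurableSet_singleton d), lintegral_singleton,
      hμ.map_increments ht, hν.map_increments ht, Measure.pi_singleton, Measure.pi_singleton]
    have hδ : ∀ i : Fin m, (0 : ℝ) ≤ (t (i + 1) : ℝ) - t i := fun i =>
      sub_nonneg.2 (by exact_mod_cast ht (Nat.le_succ _))
    simp_rw [poissonMeasure_singleton_eq ha hb (hδ _)]
    rw [Finset.prod_mul_distrib,
      ← ENNReal.ofReal_prod_of_nonneg fun i _ => poissonDensity_nonneg ha hb.le _ _,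
      prod_poissonDensity]
    have hsum : ∑ i : Fin m, ((t (i + 1) : ℝ) - t i) = t m := by
      rw [Fin.sum_univ_eq_sum_range (fun i => (t (i + 1) : ℝ) - t i) m, 
        Finset.sum_range_sub (fun i => (t i : ℝ)), h0]
      simp
    rw [hsum]
  rw [← Measure.map_apply hmeas hE, hmap, withDensity_apply _ hE,
    setLIntegral_map hE hw hmeas]
  refine lintegral_congr fun ω => ?_
  have hs : ∑ i, increments N t m ω i = N (t m) ω := by
    rw [← hμ.sum_increments ht h0 m ω]
    exact Fin.sum_univ_eq_sum_range (fun i => N (t (i + 1)) ω - N (t i) ω) m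
  rw [hs]

/-- Adjoining `0` lets increments sum to the values of the process; adjoining `T` makes the density
involve `N T`. The sequence is constant after index `m`, so it is monotone on all of `ℕ`. -/
theorem exists_monotone_enumeration (F : Finset ℝ≥0) {T : ℝ≥0} (hF : ∀ s ∈ F, s ≤ T) :
    ∃ (t : ℕ → ℝ≥0) (m : ℕ), Monotone t ∧ t 0 = 0 ∧ t m = T ∧ ∀ s ∈ F, ∃ j ≤ m, t j = s := by
  classical
  let G : Finset ℝ≥0 := insert 0 (insert T F)
  have hne : G.Nonempty := ⟨0, Finset.mem_insert_self _ _⟩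
  have hpos : 0 < G.card := hne.card_pos
  have hGT : ∀ s ∈ G, s ≤ T := by
    intro s hs
    rcases Finset.mem_insert.1 hs with rfl | hs
    · exact bot_le
    rcases Finset.mem_insert.1 hs with rfl | hs
    · exact le_rfl
    · exact hF s hs
  let e := G.orderEmbOfFin rfl
  let t : ℕ → ℝ≥0 := fun j => e ⟨min j (G.card - 1), by omega⟩
  have hex : ∀ s ∈ G, ∃ j ≤ G.card - 1, t j = s := by
    intro s hs
    have : s ∈ Set.range e := by rw [Finset.range_orderEmbOfFin]; exact hs
    obtain ⟨i, rfl⟩ := this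
    refine ⟨i, by omega, ?_⟩
    simp only [t]
    congr 1
    exact Fin.ext (min_eq_left (by omega))
  have hmono : Monotone t := fun i j hij => e.monotone (by
    simp only [Fin.mk_le_mk]
    omega)
  refine ⟨t, G.card - 1, hmono, ?_, ?_, fun s hs => hex s (by simp [G, hs])⟩
  · obtain ⟨j, -, hj⟩ := hex 0 (by simp [G])
    exact le_antisymm (hj ▸ hmono (Nat.zero_le j)) bot_le
  · obtain ⟨j, hj', hj⟩ := hex T (by simp [G])
    refine le_antisymm (hGT _ ?_) (hj ▸ hmono hj')
    exact Finset.orderEmbOfFin_mem _ _ _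

/-- The path of a process up to time `T`. -/
def pathUpTo (N : ℝ≥0 → Ω → ℕ) (T : ℝ≥0) (ω : Ω) (s : {s : ℝ≥0 // (s : ℝ) ≤ T}) : ℕ := N s ω

theorem IsPoissonProcess.measurable_pathUpTo {N : ℝ≥0 → Ω → ℕ} {r : ℝ} {μ : Measure Ω}
    (hN : IsPoissonProcess N r μ) (T : ℝ≥0) : Measurable (pathUpTo N T) :=
  measurable_pi_lambda _ fun s => hN.measurable s

/-- The last value of a path up to time `T`. -/
def endValue {T : ℝ≥0} (x : {s : ℝ≥0 // (s : ℝ) ≤ T} → ℕ) : ℕ := x ⟨T, le_rfl⟩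

theorem measurable_ofReal_poissonDensity_endValue (a b : ℝ) (T : ℝ≥0) :
    Measurable fun x : {s : ℝ≥0 // (s : ℝ) ≤ T} → ℕ =>
      ENNReal.ofReal (poissonDensity a b T (endValue x)) :=
  (Measurable.of_discrete (f := fun k => ENNReal.ofReal (poissonDensity a b T k))).comp
    (measurable_pi_apply _)

/-- The law of the Poisson process of rate `a` on `[0, T]` has a density with respect to that of
the Poisson process of rate `b`. -/
theorem IsPoissonProcess.map_pathUpTo {N : ℝ≥0 → Ω → ℕ} {a b : ℝ} {μ ν : Measure Ω}
    [IsFiniteMeasure μ]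
    (hμ : IsPoissonProcess N a μ) (hν : IsPoissonProcess N b ν) (ha : 0 ≤ a) (hb : 0 < b)
    (T : ℝ≥0) :
    μ.map (pathUpTo N T) = (ν.map (pathUpTo N T)).withDensity
      fun x => ENNReal.ofReal (poissonDensity a b T (endValue x)) := by
  classical
  have hm := hμ.measurable_pathUpTo T
  -- Finite-dimensional distributions determine the law of the path, so it is enough to compare
  -- these.
  have hlim : IsProjectiveLimit (μ.map (pathUpTo N T))
      (fun I => (μ.map (pathUpTo N T)).map I.restrict) := fun I => rfl
  refine hlim.unique fun I => ?_
  ext E hE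
  have hE' : MeasurableSet (I.restrict ⁻¹' E : Set ({s : ℝ≥0 // (s : ℝ) ≤ T} → ℕ)) :=
    Finset.measurable_restrict I hE
  rw [Measure.map_apply (Finset.measurable_restrict I) hE,
    Measure.map_apply (Finset.measurable_restrict I) hE, Measure.map_apply hm hE',
    withDensity_apply _ hE', setLIntegral_map hE'
      (measurable_ofReal_poissonDensity_endValue a b T) hm]
  obtain ⟨t, m, ht, h0, htm, hex⟩ := exists_monotone_enumeration (I.image Subtype.val)
    (T := T) (by
      intro s hs
      obtain ⟨x, -, rfl⟩ := Finset.mem_image.1 hs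
      exact NNReal.coe_le_coe.1 x.2)
  have hex' : ∀ s : I, ∃ j ≤ m, t j = (s : {s : ℝ≥0 // (s : ℝ) ≤ T}) := fun s =>
    hex _ (Finset.mem_image_of_mem _ s.2)
  choose j hjm hj using hex'
  -- Values at the chosen times are partial sums of increments. The default `0` is never used, since
  -- `j s ≤ m`.
  let Φ : (Fin m → ℕ) → (I → ℕ) := fun d s =>
    ∑ i ∈ Finset.range (j s), if h : i < m then d ⟨i, h⟩ else 0
  have hset : pathUpTo N T ⁻¹' (I.restrict ⁻¹' E) = increments N t m ⁻¹' (Φ ⁻¹' E) := by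
    ext ω
    have : I.restrict (pathUpTo N T ω) = Φ (increments N t m ω) := by
      ext s
      simp only [Finset.restrict, pathUpTo, Φ, increments]
      rw [← hj s, ← hμ.sum_increments ht h0 (j s) ω]
      refine Finset.sum_congr rfl fun i hi => ?_
      rw [dif_pos ((Finset.mem_range.1 hi).trans_le (hjm s))]
    simp only [Set.mem_preimage, this]
  rw [hset, hμ.measure_increments_preimage hν ha hb ht h0 m, htm]
  rfl

theorem IsTelegraph.map_velocity {v : ℝ} (hv : 0 < v) {V₀ : Ω → ℝ} {N : ℝ≥0 → Ω → ℕ} {r : ℝ}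
    {μ : Measure Ω} [IsProbabilityMeasure μ] (h : IsTelegraph v V₀ N r μ) :
    μ.map V₀ = (1 / 2 : ℝ≥0∞) • Measure.dirac v + (1 / 2 : ℝ≥0∞) • Measure.dirac (-v) := by
  have hm := h.measurable_velocity
  have hne : v ≠ -v := by linarith
  have := Measure.isProbabilityMeasure_map (μ := μ) hm.aemeasurable
  set ρ := μ.map V₀
  have h1 : ρ {v} = 1 / 2 := by
    rw [Measure.map_apply hm (measurableSet_singleton v)]; exact h.prob_pos
  have h2 : ρ {-v} = 1 / 2 := by
    rw [Measure.map_apply hm (measurableSet_singleton _)]; exact h.prob_neg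
  have hae : ∀ᵐ x ∂ρ, x ∈ ({v} ∪ {-v} : Set ℝ) := by
    refine (mem_ae_iff_prob_eq_one (by measurability)).2 ?_
    change ρ ({v} ∪ {-v}) = 1
    rw [measure_union (Set.disjoint_singleton.2 hne) (measurableSet_singleton _), h1, h2,
      ENNReal.add_halves]
  rw [← Measure.restrict_eq_self_of_ae_mem hae,
    Measure.restrict_union (Set.disjoint_singleton.2 hne) (measurableSet_singleton _),
    Measure.restrict_singleton, Measure.restrict_singleton, h1, h2]

/-- The data of the continuous-time experiment. -/
def observation (V₀ : Ω → ℝ) (N : ℝ≥0 → Ω → ℕ) (T : ℝ≥0) (ω : Ω) :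
    ℝ × ({s : ℝ≥0 // (s : ℝ) ≤ T} → ℕ) := (V₀ ω, pathUpTo N T ω)

theorem IsTelegraph.measurable_observation {v : ℝ} {V₀ : Ω → ℝ} {N : ℝ≥0 → Ω → ℕ} {r : ℝ}
    {μ : Measure Ω} (h : IsTelegraph v V₀ N r μ) (T : ℝ≥0) : Measurable (observation V₀ N T) :=
  h.measurable_velocity.prodMk (h.poisson.measurable_pathUpTo T)

omit mΩ in
theorem observed_eq_comap (V₀ : Ω → ℝ) (N : ℝ≥0 → Ω → ℕ) (T : ℝ≥0) :
    observed V₀ N T = MeasurableSpace.comap (observation V₀ N T) inferInstance := by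
  have h1 := MeasurableSpace.comap_prodMk (mβ := (inferInstance : MeasurableSpace ℝ))
    (mγ := (inferInstance : MeasurableSpace ({s : ℝ≥0 // (s : ℝ) ≤ T} → ℕ))) V₀ (pathUpTo N T)
  have h2 := MeasurableSpace.comap_process_pi
    (fun (s : {s : ℝ≥0 // (s : ℝ) ≤ T}) (ω : Ω) => N s ω)
  refine Eq.trans ?_ h1.symm
  rw [observed]
  congr 1
  exact h2.symm

theorem IsTelegraph.map_observation_eq_prod {v : ℝ} {V₀ : Ω → ℝ} {N : ℝ≥0 → Ω → ℕ} {r : ℝ}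
    {μ : Measure Ω} [IsProbabilityMeasure μ] (h : IsTelegraph v V₀ N r μ) (T : ℝ≥0) :
    μ.map (observation V₀ N T) = (μ.map V₀).prod (μ.map (pathUpTo N T)) := by
  have hψ : Measurable fun (x : ℝ≥0 → ℕ) (s : {s : ℝ≥0 // (s : ℝ) ≤ T}) => x (s : ℝ≥0) :=
    measurable_pi_lambda _ fun s => measurable_pi_apply _
  have hind : IndepFun V₀ (pathUpTo N T) μ := h.indep.comp measurable_id hψ
  exact hind.map_prod_eq_prod_map_map h.measurable_velocity.aemeasurable
    (h.poisson.measurable_pathUpTo T).aemeasurable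

/-- The initial velocity is independent of `N` and its law does not depend on the rate, so it
contributes nothing to the likelihood ratio. -/
theorem IsTelegraph.map_observation {v : ℝ} (hv : 0 < v) {V₀ : Ω → ℝ} {N : ℝ≥0 → Ω → ℕ} {a b : ℝ}
    {μ ν : Measure Ω} [IsProbabilityMeasure μ] [IsProbabilityMeasure ν]
    (hμ : IsTelegraph v V₀ N a μ) (hν : IsTelegraph v V₀ N b ν) (ha : 0 ≤ a) (hb : 0 < b)
    (T : ℝ≥0) :
    μ.map (observation V₀ N T) = (ν.map (observation V₀ N T)).withDensity
      fun x => ENNReal.ofReal (poissonDensity a b T (endValue x.2)) := by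
  have hfin : IsFiniteMeasure ((ν.map (pathUpTo N T)).withDensity
      fun x => ENNReal.ofReal (poissonDensity a b T (endValue x))) := by
    rw [← hμ.poisson.map_pathUpTo hν.poisson ha hb T]
    infer_instance
  rw [hμ.map_observation_eq_prod, hν.map_observation_eq_prod, hμ.map_velocity hv,
    hν.map_velocity hv, hμ.poisson.map_pathUpTo hν.poisson ha hb T,
    prod_withDensity_right (measurable_ofReal_poissonDensity_endValue a b T)]

/-- Change of measure: expectations of functions of the continuous-time data under rate `a` are
weighted expectations under rate `b`. -/
theorem IsTelegraph.integral_eq {v : ℝ} (hv : 0 < v) {V₀ : Ω → ℝ} {N : ℝ≥0 → Ω → ℕ} {a b : ℝ}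
    {μ ν : Measure Ω} [IsProbabilityMeasure μ] [IsProbabilityMeasure ν]
    (hμ : IsTelegraph v V₀ N a μ) (hν : IsTelegraph v V₀ N b ν) (ha : 0 ≤ a) (hb : 0 < b)
    {T : ℝ} (hT : 0 ≤ T) {Z : Ω → ℝ} (hZ : Measurable[observed V₀ N T] Z) :
    ∫ ω, Z ω ∂μ = ∫ ω, poissonDensity a b T (N T.toNNReal ω) * Z ω ∂ν := by
  lift T to ℝ≥0 using hT
  rw [observed_eq_comap] at hZ
  -- Doob–Dynkin: a statistic measurable for the observed data is a function of `observation`.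
  obtain ⟨g, hg, rfl⟩ := hZ.exists_eq_measurable_comp
  have hobs := hμ.measurable_observation T
  have hd : Measurable fun x : ℝ × ({s : ℝ≥0 // (s : ℝ) ≤ T} → ℕ) =>
      ENNReal.ofReal (poissonDensity a b T (endValue x.2)) :=
    (measurable_ofReal_poissonDensity_endValue a b T).comp measurable_snd
  have h1 : ∫ ω, (g ∘ observation V₀ N T) ω ∂μ = ∫ x, g x ∂(μ.map (observation V₀ N T)) :=
    (integral_map hobs.aemeasurable hg.aestronglyMeasurable).symm
  have h2 : Measurable fun x : ℝ × ({s : ℝ≥0 // (s : ℝ) ≤ T} → ℕ) =>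
      (ENNReal.ofReal (poissonDensity a b T (endValue x.2))).toReal • g x :=
    hd.ennreal_toReal.smul hg
  rw [h1, hμ.map_observation hv hν ha hb T, integral_withDensity_eq_integral_toReal_smul hd
    (Eventually.of_forall fun _ => ENNReal.ofReal_lt_top),
    integral_map hobs.aemeasurable h2.aestronglyMeasurable]
  refine integral_congr_ae (Eventually.of_forall fun ω => ?_)
  simp only [smul_eq_mul, Function.comp_apply, Real.toNNReal_coe]
  rw [ENNReal.toReal_ofReal (poissonDensity_nonneg ha hb.le _ _)]
  rfl

/-! ### Moments of the likelihood ratio and the Chapman–Robbins inequality -/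

theorem integrable_pow_poissonMeasure {r : ℝ≥0} {x : ℝ} (hx : 0 ≤ x) :
    Integrable (fun k : ℕ => x ^ k) (poissonMeasure r) ∧
      ∫ k, x ^ k ∂(poissonMeasure r) = Real.exp (r * (x - 1)) := by
  have hs : HasSum (fun k : ℕ => Real.exp (-r) * r ^ k / k.factorial * x ^ k)
      (Real.exp (r * (x - 1))) := by
    have h1 := (NormedSpace.expSeries_div_hasSum_exp ((r : ℝ) * x)).mul_left (Real.exp (-r))
    rw [← Real.exp_eq_exp_ℝ, ← Real.exp_add] at h1
    convert! h1 using 1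
    · ext k
      rw [mul_pow]
      ring
    · ring_nf
  refine ⟨integrable_poissonMeasure_iff.2 ?_, ?_⟩
  · refine hs.summable.congr fun k => ?_
    rw [Real.norm_of_nonneg (by positivity)]
  · rw [integral_poissonMeasure]
    simpa using hs.tsum_eq

theorem IsPoissonProcess.hasLaw {N : ℝ≥0 → Ω → ℕ} {r : ℝ} {μ : Measure Ω}
    (hN : IsPoissonProcess N r μ) (t : ℝ≥0) : HasLaw (N t) (poissonMeasure (r * t).toNNReal) μ := by
  have := hN.law_increment 0 t bot_le
  simpa [hN.zero] using this

theorem IsPoissonProcess.integrable_pow {N : ℝ≥0 → Ω → ℕ} {r : ℝ} {μ : Measure Ω}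
    (hN : IsPoissonProcess N r μ) (hr : 0 ≤ r) (t : ℝ≥0) {x : ℝ} (hx : 0 ≤ x) :
    Integrable (fun ω => x ^ N t ω) μ ∧ ∫ ω, x ^ N t ω ∂μ = Real.exp (r * t * (x - 1)) := by
  have hl := hN.hasLaw t
  obtain ⟨h1, h2⟩ := integrable_pow_poissonMeasure (r := (r * t).toNNReal) hx
  rw [Real.coe_toNNReal _ (by positivity)] at h2
  rw [← hl.map_eq] at h1 h2
  refine ⟨h1.comp_measurable (hN.measurable t), ?_⟩
  rw [integral_map (hN.measurable t).aemeasurable h1.aestronglyMeasurable] at h2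
  exact h2

/-- The density is geometric in the count, so the generating function gives its moments. For the
second one the exponent is `b * T * ((a / b) ^ 2 - 1) - 2 * (a - b) * T = T * (a - b) ^ 2 / b`. -/
theorem IsPoissonProcess.poissonDensity_moments {N : ℝ≥0 → Ω → ℕ} {a b : ℝ} {μ : Measure Ω}
    (hN : IsPoissonProcess N b μ) (ha : 0 ≤ a) (hb : 0 < b) (T : ℝ≥0) :
    Integrable (fun ω => poissonDensity a b T (N T ω)) μ ∧
      ∫ ω, poissonDensity a b T (N T ω) ∂μ = 1 ∧
      Integrable (fun ω => poissonDensity a b T (N T ω) ^ 2) μ ∧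
      ∫ ω, poissonDensity a b T (N T ω) ^ 2 ∂μ = Real.exp (T * (a - b) ^ 2 / b) := by
  have hab : 0 ≤ a / b := by positivity
  obtain ⟨h1, h2⟩ := hN.integrable_pow hb.le T hab
  obtain ⟨h3, h4⟩ := hN.integrable_pow hb.le T (sq_nonneg (a / b))
  have hsq : ∀ ω, poissonDensity a b T (N T ω) ^ 2 =
      ((a / b) ^ 2) ^ N T ω * Real.exp (-((a - b) * T)) ^ 2 := fun ω => by
    rw [poissonDensity, mul_pow, ← pow_mul, ← pow_mul, mul_comm 2]
  simp_rw [hsq]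
  simp only [poissonDensity]
  refine ⟨h1.mul_const _, ?_, h3.mul_const _, ?_⟩
  · rw [integral_mul_const, h2, ← Real.exp_add, Real.exp_eq_one_iff]
    field_simp
    ring
  · rw [integral_mul_const, h4, ← Real.exp_nat_mul, ← Real.exp_add]
    congr 1
    push_cast
    field_simp
    ring

/-- Cauchy–Schwarz: the quadratic `x ↦ ∫ (f * x + g) ^ 2` is nonnegative, so its discriminant is not
positive. -/
theorem sq_integral_mul_le {μ : Measure Ω} {f g : Ω → ℝ} (hf : Integrable (fun ω => f ω ^ 2) μ)
    (hg : Integrable (fun ω => g ω ^ 2) μ) (hfg : Integrable (fun ω => f ω * g ω) μ) :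
    (∫ ω, f ω * g ω ∂μ) ^ 2 ≤ (∫ ω, f ω ^ 2 ∂μ) * ∫ ω, g ω ^ 2 ∂μ := by
  have h : ∀ x : ℝ, 0 ≤ (∫ ω, f ω ^ 2 ∂μ) * (x * x) + (2 * ∫ ω, f ω * g ω ∂μ) * x +
      ∫ ω, g ω ^ 2 ∂μ := by
    intro x
    have h1 : 0 ≤ ∫ ω, (f ω ^ 2 * (x * x) + (f ω * g ω) * (2 * x)) + g ω ^ 2 ∂μ :=
      integral_nonneg fun ω => by
        have : (f ω ^ 2 * (x * x) + (f ω * g ω) * (2 * x)) + g ω ^ 2 = (f ω * x + g ω) ^ 2 := by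
          ring
        rw [this]
        exact sq_nonneg _
    have h2 : Integrable (fun ω => f ω ^ 2 * (x * x) + (f ω * g ω) * (2 * x)) μ :=
      (hf.mul_const _).add (hfg.mul_const _)
    rw [integral_add h2 hg,
      integral_add (hf.mul_const _) (hfg.mul_const _), integral_mul_const, integral_mul_const] at h1
    linarith
  have := discrim_le_zero h
  rw [discrim] at this
  nlinarith

/-- The Chapman–Robbins inequality for bounded statistics of the continuous-time experiment. -/
theorem IsTelegraph.sq_integral_sub_le {v : ℝ} (hv : 0 < v) {V₀ : Ω → ℝ} {N : ℝ≥0 → Ω → ℕ}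
    {a b : ℝ} {μ ν : Measure Ω} [IsProbabilityMeasure μ] [IsProbabilityMeasure ν]
    (hμ : IsTelegraph v V₀ N a μ) (hν : IsTelegraph v V₀ N b ν) (ha : 0 ≤ a) (hb : 0 < b)
    {T : ℝ} (hT : 0 ≤ T) {Z : Ω → ℝ} (hZ : Measurable[observed V₀ N T] Z) {C : ℝ}
    (hC : ∀ ω, |Z ω| ≤ C) (c : ℝ) :
    (∫ ω, Z ω ∂μ - ∫ ω, Z ω ∂ν) ^ 2 ≤
      (∫ ω, (Z ω - c) ^ 2 ∂ν) * (Real.exp (T * (a - b) ^ 2 / b) - 1) := by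
  have hZm : Measurable Z := hZ.mono
    (observed_le hν.measurable_velocity hν.poisson.measurable T) le_rfl
  rw [hμ.integral_eq hv hν ha hb hT hZ]
  lift T to ℝ≥0 using hT
  rw [Real.toNNReal_coe]
  obtain ⟨h1, h2, h3, h4⟩ := hν.poisson.poissonDensity_moments ha hb T
  set W : Ω → ℝ := fun ω => poissonDensity a b T (N T ω)
  have hZi : Integrable Z ν := Integrable.of_bound hZm.aestronglyMeasurable C
    (Eventually.of_forall hC)
  have hWZ : Integrable (fun ω => W ω * Z ω) ν :=
    h1.mul_bdd (c := C) hZm.aestronglyMeasurable (Eventually.of_forall hC)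
  have hZ2 : Integrable (fun ω => (Z ω - c) ^ 2) ν := by
    refine Integrable.of_bound ((hZm.sub_const c).pow_const 2).aestronglyMeasurable
      ((C + |c|) ^ 2) (Eventually.of_forall fun ω => ?_)
    rw [Real.norm_eq_abs, abs_pow]
    gcongr
    exact (abs_sub _ _).trans (add_le_add (hC ω) le_rfl)
  have hW2 : ∫ ω, (W ω - 1) ^ 2 ∂ν = Real.exp (T * (a - b) ^ 2 / b) - 1 ∧
      Integrable (fun ω => (W ω - 1) ^ 2) ν := by
    have he : ∀ ω, (W ω - 1) ^ 2 = (W ω ^ 2 - W ω * 2) + 1 := fun ω => by ring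
    simp_rw [he]
    have h5 : Integrable (fun ω => W ω ^ 2 - W ω * 2) ν := h3.sub (h1.mul_const 2)
    refine ⟨?_, h5.add (integrable_const 1)⟩
    rw [integral_add h5 (integrable_const 1),
      integral_sub h3 (h1.mul_const 2), integral_mul_const, h4, h2]
    simp
    ring
  -- Since `W - 1` has mean zero, the constant `c` drops out of the covariance.
  have hprod : ∀ ω, (Z ω - c) * (W ω - 1) = (W ω * Z ω - Z ω) - (W ω - 1) * c := fun ω => by ring
  have hWc : Integrable (fun ω => (W ω - 1) * c) ν := (h1.sub (integrable_const 1)).mul_const c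
  have hWZ' : Integrable (fun ω => W ω * Z ω - Z ω) ν := hWZ.sub hZi
  have hint : Integrable (fun ω => (Z ω - c) * (W ω - 1)) ν := by
    simp_rw [hprod]
    exact hWZ'.sub hWc
  have hcs := sq_integral_mul_le hZ2 hW2.2 hint
  have hval : ∫ ω, (Z ω - c) * (W ω - 1) ∂ν = ∫ ω, W ω * Z ω ∂ν - ∫ ω, Z ω ∂ν := by
    simp_rw [hprod]
    rw [integral_sub hWZ' hWc, integral_sub hWZ hZi, integral_mul_const,
      integral_sub h1 (integrable_const 1), h2]
    simp
  rw [hval, hW2.1] at hcs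
  exact hcs

/-! ### The lower bound for the variance of a regular limit law -/

theorem tendsto_integral_comp {μ : ℕ → Measure Ω} [∀ n, IsProbabilityMeasure (μ n)]
    {L : Measure ℝ} [IsProbabilityMeasure L] {X : ℕ → Ω → ℝ}
    (hX : TendstoInDistribution X atTop (id : ℝ → ℝ) μ L) {f : ℝ → ℝ} (hf : Continuous f) {C : ℝ}
    (hC : ∀ x, |f x| ≤ C) :
    Tendsto (fun n => ∫ ω, f (X n ω) ∂(μ n)) atTop (𝓝 (∫ x, f x ∂L)) := by
  have := ProbabilityMeasure.tendsto_iff_forall_integral_tendsto.1 hX.tendsto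
    (BoundedContinuousFunction.ofNormedAddCommGroup f hf C hC)
  simp only [ProbabilityMeasure.coe_mk, Measure.map_id,
    BoundedContinuousFunction.coe_ofNormedAddCommGroup] at this
  refine this.congr fun n => ?_
  rw [integral_map (hX.forall_aemeasurable n) hf.aestronglyMeasurable]

/-- Truncation of a real number to `[-M, M]`. -/
def truncate (M x : ℝ) : ℝ := max (-M) (min M x)

theorem continuous_truncate (M : ℝ) : Continuous (truncate M) :=
  continuous_const.max (continuous_const.min continuous_id)

theorem abs_truncate_le {M : ℝ} (hM : 0 ≤ M) (x : ℝ) : |truncate M x| ≤ M :=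
  abs_le.2 ⟨le_max_left _ _, max_le (by linarith) (min_le_left _ _)⟩

theorem abs_truncate_le_abs {M : ℝ} (hM : 0 ≤ M) (x : ℝ) : |truncate M x| ≤ |x| := by
  refine abs_le.2 ⟨le_max_of_le_right (le_min ?_ (neg_abs_le x)), max_le ?_ ?_⟩
  · linarith [abs_nonneg x]
  · linarith [abs_nonneg x]
  · exact (min_le_right _ _).trans (le_abs_self x)

theorem tendsto_truncate (x : ℝ) : Tendsto (fun M : ℕ => truncate M x) atTop (𝓝 x) := by
  refine tendsto_const_nhds.congr' ?_
  filter_upwards [eventually_ge_atTop ⌈|x|⌉₊] with M hM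
  have h1 : |x| ≤ M := (Nat.le_ceil _).trans (by exact_mod_cast hM)
  have h2 := abs_le.1 h1
  rw [truncate, min_eq_right h2.2, max_eq_right h2.1]

theorem exists_local_parameters (θ₀ : Set.Ioi (0 : ℝ)) {T : ℕ → ℝ} (hT : Tendsto T atTop atTop)
    (h : ℝ) : ∃ θ : ℕ → Set.Ioi (0 : ℝ), ∀ᶠ n in atTop, (θ n : ℝ) = θ₀ + h / √(T n) := by
  classical
  refine ⟨fun n => if hn : 0 < (θ₀ : ℝ) + h / √(T n) then ⟨_, hn⟩ else θ₀, ?_⟩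
  have hlim : Tendsto (fun n => (θ₀ : ℝ) + h / √(T n)) atTop (𝓝 (θ₀ + 0)) :=
    tendsto_const_nhds.add (tendsto_const_nhds.div_atTop (Real.tendsto_sqrt_atTop.comp hT))
  rw [add_zero] at hlim
  filter_upwards [hlim.eventually_const_lt θ₀.2] with n hn
  rw [dif_pos hn]

section LowerBound

variable {P : Set.Ioi (0 : ℝ) → Measure Ω} [∀ θ, IsProbabilityMeasure (P θ)] {v : ℝ}
  {V₀ : Ω → ℝ} {N : ℝ≥0 → Ω → ℕ} {T : ℕ → ℝ} {θ₀ : Set.Ioi (0 : ℝ)} {S : ℕ → Ω → ℝ}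
  {L : Measure ℝ} [IsProbabilityMeasure L]

/-- The Chapman–Robbins inequality, passed to the limit along a regular sequence of estimators. -/
theorem IsRegularAt.sq_integral_truncate_sub_le (hv : 0 < v)
    (hX : ∀ θ : Set.Ioi (0 : ℝ), IsTelegraph v V₀ N θ (P θ)) (hT : Tendsto T atTop atTop)
    (hS : IsRegularAt P (fun n => observed V₀ N (T n)) T S θ₀ L) (h c : ℝ) {M : ℝ} (hM : 0 ≤ M) :
    (∫ y, truncate M (y + h) ∂L - ∫ y, truncate M y ∂L) ^ 2 ≤
      (∫ y, (truncate M y - c) ^ 2 ∂L) * (Real.exp (h ^ 2 / θ₀) - 1) := by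
  obtain ⟨θ, hθ⟩ := exists_local_parameters θ₀ hT h
  have hd1 := hS.2 h θ hθ
  have hd0 := hS.2 0 (fun _ => θ₀) (Eventually.of_forall fun n => by simp)
  let Y : ℕ → Ω → ℝ := fun n ω => √(T n) * (S n ω - θ₀)
  have hTpos : ∀ᶠ n in atTop, 0 < T n := hT.eventually_gt_atTop 0
  have hsq : ∀ x, |(truncate M x - c) ^ 2| ≤ (M + |c|) ^ 2 := fun x => by
    rw [abs_pow]
    gcongr
    exact (abs_sub _ _).trans (add_le_add (abs_truncate_le hM x) le_rfl)
  -- Centering at `θ₀` instead of `θ n` adds exactly `h`, so under `P (θ n)` the limit law is `L`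
  -- shifted by `h`.
  have l1 : Tendsto (fun n => ∫ ω, truncate M (Y n ω) ∂(P (θ n))) atTop
      (𝓝 (∫ y, truncate M (y + h) ∂L)) := by
    have h1 := tendsto_integral_comp hd1 (f := fun y => truncate M (y + h))
      ((continuous_truncate M).comp (continuous_id.add continuous_const))
      (fun x => abs_truncate_le hM _)
    refine h1.congr' ?_
    filter_upwards [hθ, hTpos] with n hn hTn
    refine integral_congr_ae (Eventually.of_forall fun ω => ?_)
    simp only [Y, hn]
    have := (Real.sqrt_pos.2 hTn).ne'
    congr 1
    field_simp
    ring
  have l0 : Tendsto (fun n => ∫ ω, truncate M (Y n ω) ∂(P θ₀)) atTop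
      (𝓝 (∫ y, truncate M y ∂L)) :=
    tendsto_integral_comp hd0 (continuous_truncate M) (abs_truncate_le hM)
  have l2 : Tendsto (fun n => ∫ ω, (truncate M (Y n ω) - c) ^ 2 ∂(P θ₀)) atTop
      (𝓝 (∫ y, (truncate M y - c) ^ 2 ∂L)) :=
    tendsto_integral_comp hd0 (f := fun y => (truncate M y - c) ^ 2)
      (((continuous_truncate M).sub continuous_const).pow 2) hsq
  refine le_of_tendsto_of_tendsto ((l1.sub l0).pow 2) (l2.mul_const _) ?_
  filter_upwards [hθ, hTpos] with n hn hTn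
  have hZ : Measurable[observed V₀ N (T n)] fun ω => truncate M (Y n ω) :=
    (continuous_truncate M).measurable.comp (((hS.1 n).sub_const _).const_mul _)
  have h1 := (hX (θ n)).sq_integral_sub_le hv (hX θ₀) (le_of_lt (θ n).2) θ₀.2 hTn.le hZ
    (fun ω => abs_truncate_le hM _) c
  -- The local scaling makes the exponent in the Chapman–Robbins bound independent of `n`.
  have h2 : T n * ((θ n : ℝ) - θ₀) ^ 2 = h ^ 2 := by
    rw [hn, add_sub_cancel_left, div_pow, Real.sq_sqrt hTn.le, mul_div_cancel₀ _ hTn.ne']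
  rwa [h2] at h1

/-- The truncation level tends to infinity by dominated convergence. With `c` the mean of `L`, the
first factor on the right becomes the variance, and the means of `y + h` and `y` differ by `h`. -/
theorem IsRegularAt.sq_le_variance_mul (hv : 0 < v)
    (hX : ∀ θ : Set.Ioi (0 : ℝ), IsTelegraph v V₀ N θ (P θ)) (hT : Tendsto T atTop atTop)
    (hS : IsRegularAt P (fun n => observed V₀ N (T n)) T S θ₀ L) (hL : MemLp id 2 L) (h : ℝ) :
    h ^ 2 ≤ variance id L * (Real.exp (h ^ 2 / θ₀) - 1) := by
  have hint : Integrable (fun y : ℝ => y) L := memLp_one_iff_integrable.1 (hL.mono_exponent (by simp))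
  have hinth : Integrable (fun y : ℝ => y + h) L := hint.add (integrable_const h)
  set c := ∫ y, y ∂L with hc
  have habs : MemLp (fun y : ℝ => |y| + |c|) 2 L := hL.norm.add (memLp_const |c|)
  have l1 : Tendsto (fun M : ℕ => ∫ y, truncate M (y + h) ∂L) atTop (𝓝 (∫ y, y + h ∂L)) :=
    tendsto_integral_of_dominated_convergence (fun y => |y + h|)
      (fun M => ((continuous_truncate M).comp
        (continuous_id.add continuous_const)).aestronglyMeasurable) hinth.abs
      (fun M => Eventually.of_forall fun y => abs_truncate_le_abs M.cast_nonneg _)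
      (Eventually.of_forall fun y => tendsto_truncate _)
  have l0 : Tendsto (fun M : ℕ => ∫ y, truncate M y ∂L) atTop (𝓝 (∫ y, y ∂L)) :=
    tendsto_integral_of_dominated_convergence (fun y => |y|)
      (fun M => (continuous_truncate M).aestronglyMeasurable) hint.abs
      (fun M => Eventually.of_forall fun y => abs_truncate_le_abs M.cast_nonneg _)
      (Eventually.of_forall fun y => tendsto_truncate _)
  have l2 : Tendsto (fun M : ℕ => ∫ y, (truncate M y - c) ^ 2 ∂L) atTop
      (𝓝 (∫ y, (y - c) ^ 2 ∂L)) :=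
    tendsto_integral_of_dominated_convergence (fun y => (|y| + |c|) ^ 2)
      (fun M => (((continuous_truncate M).sub continuous_const).pow 2).aestronglyMeasurable)
      habs.integrable_sq
      (fun M => Eventually.of_forall fun y => by
        rw [Real.norm_eq_abs, abs_pow]
        gcongr
        exact (abs_sub _ _).trans (add_le_add (abs_truncate_le_abs M.cast_nonneg y) le_rfl))
      (Eventually.of_forall fun y => ((tendsto_truncate y).sub_const c).pow 2)
  have hlim := le_of_tendsto_of_tendsto ((l1.sub l0).pow 2)
    (l2.mul_const (Real.exp (h ^ 2 / θ₀) - 1))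
    (Eventually.of_forall fun M => hS.sq_integral_truncate_sub_le hv hX hT h c M.cast_nonneg)
  rw [integral_add hint (integrable_const h)] at hlim
  rw [variance_eq_integral aemeasurable_id]
  simpa using hlim

/-- Put `h ^ 2 = θ * x`, use `exp x - 1 ≤ x + x ^ 2` for small `x > 0`, divide by `x`, and let `x →
0`. -/
theorem le_of_forall_sq_le_mul_exp {V θ : ℝ} (hθ : 0 < θ)
    (hV : ∀ h : ℝ, h ^ 2 ≤ V * (Real.exp (h ^ 2 / θ) - 1)) : θ ≤ V := by
  have hV0 : 0 ≤ V := by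
    by_contra hneg
    have h1 := hV 1
    have h2 : 0 < Real.exp (1 ^ 2 / θ) - 1 := by
      rw [sub_pos, Real.one_lt_exp_iff]
      positivity
    nlinarith
  have hlim : Tendsto (fun x : ℝ => V * (1 + x)) (𝓝[>] 0) (𝓝 (V * (1 + 0))) :=
    ((continuous_const.mul (continuous_const.add continuous_id)).tendsto 0).mono_left
      nhdsWithin_le_nhds
  rw [add_zero, mul_one] at hlim
  refine ge_of_tendsto hlim ?_
  filter_upwards [Ioo_mem_nhdsGT (zero_lt_one' ℝ)] with x hx
  have h1 := hV √(θ * x)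
  rw [Real.sq_sqrt (mul_nonneg hθ.le hx.1.le), mul_div_cancel_left₀ _ hθ.ne'] at h1
  have h2 := (abs_le.1 (Real.abs_exp_sub_one_sub_id_le (x := x) (by
    rw [abs_of_pos hx.1]; exact hx.2.le))).2
  have h3 : θ * x ≤ (V * (1 + x)) * x := h1.trans (by nlinarith)
  exact le_of_mul_le_mul_right h3 hx.1

theorem IsRegularAt.le_evariance (hv : 0 < v)
    (hX : ∀ θ : Set.Ioi (0 : ℝ), IsTelegraph v V₀ N θ (P θ)) (hT : Tendsto T atTop atTop)
    (hS : IsRegularAt P (fun n => observed V₀ N (T n)) T S θ₀ L) :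
    ENNReal.ofReal θ₀ ≤ evariance id L := by
  by_cases hL : MemLp id 2 L
  · rw [← ofReal_variance hL]
    exact ENNReal.ofReal_le_ofReal (le_of_forall_sq_le_mul_exp θ₀.2 fun h =>
      hS.sq_le_variance_mul hv hX hT hL h)
  · rw [evariance_eq_top aestronglyMeasurable_id hL]
    exact le_top

end LowerBound

/-! ### Consistency and the main theorem -/

/-- A deviation of `ε` in `X n` is a deviation of `a n * ε → ∞` in a tight sequence. -/
theorem tendstoInMeasure_of_tendstoInDistribution_mul {μ : Measure Ω} [IsProbabilityMeasure μ]
    {L : Measure ℝ} [IsProbabilityMeasure L] {X : ℕ → Ω → ℝ} {x : ℝ} {a : ℕ → ℝ}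
    (ha : Tendsto a atTop atTop)
    (h : TendstoInDistribution (fun n ω => a n * (X n ω - x)) atTop (id : ℝ → ℝ) (fun _ => μ) L) :
    TendstoInMeasure μ X atTop fun _ => x := by
  rw [tendstoInMeasure_iff_dist]
  intro ε hε
  have h1 := tendsto_measure_ge_of_tendstoInDistribution h (ha.atTop_mul_const hε)
  refine tendsto_of_tendsto_of_tendsto_of_le_of_le' tendsto_const_nhds h1
    (Eventually.of_forall fun n => bot_le) ?_
  filter_upwards [ha.eventually_ge_atTop 0] with n hn
  refine measure_mono fun ω hω => ?_
  have hω' : ε ≤ |X n ω - x| := hω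
  change a n * ε ≤ |a n * (X n ω - x)|
  rw [abs_mul, abs_of_nonneg hn]
  gcongr

end Telegraph

end

theorem theorem3 {Ω : Type*} [MeasurableSpace Ω]
    (P : Set.Ioi (0 : ℝ) → Measure Ω) [∀ θ, IsProbabilityMeasure (P θ)]
    (v : ℝ) (hv : 0 < v) (V₀ : Ω → ℝ) (N : ℝ≥0 → Ω → ℕ)
    (hX : ∀ θ : Set.Ioi (0 : ℝ), Telegraph.IsTelegraph v V₀ N θ (P θ))
    (Δ : ℕ → ℝ) (hΔ_pos : ∀ n, 0 < Δ n)
    (hΔ : Tendsto Δ atTop (𝓝 0)) (hnΔ : Tendsto (fun n : ℕ => n * Δ n) atTop atTop)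
    (lam₀ : Set.Ioi (0 : ℝ)) :
    TendstoInMeasure (P lam₀)
        (fun n => Telegraph.lamHat v (Telegraph.position V₀ N) (Δ n) n) atTop
        (fun _ => (lam₀ : ℝ)) ∧
      TendstoInDistribution
        (fun (n : ℕ) ω => √(n * Δ n) *
          (Telegraph.lamHat v (Telegraph.position V₀ N) (Δ n) n ω - lam₀))
        atTop (id : ℝ → ℝ) (fun _ => P lam₀) (gaussianReal 0 (lam₀ : ℝ).toNNReal) ∧
      Telegraph.IsEfficientAt P (fun n => Telegraph.observed V₀ N (n * Δ n)) (fun n => n * Δ n)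
        (fun n => Telegraph.lamHat v (Telegraph.position V₀ N) (Δ n) n) lam₀
        (gaussianReal 0 (lam₀ : ℝ).toNNReal) := by
  have hsqrt : Tendsto (fun n : ℕ => √(n * Δ n)) atTop atTop :=
    Real.tendsto_sqrt_atTop.comp hnΔ
  have hnormal := Telegraph.tendstoInDistribution_lamHat hv hX hΔ_pos hΔ hnΔ (θ₀ := lam₀)
    (θ := fun _ => lam₀) tendsto_const_nhds
  refine ⟨Telegraph.tendstoInMeasure_of_tendstoInDistribution_mul hsqrt hnormal, hnormal,
    ⟨fun n => Telegraph.measurable_observed_lamHat v V₀ (hX lam₀).poisson.rightCont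
      (hΔ_pos n).le n, fun h θ hθ => ?_⟩, fun S' L' _ hS' => ?_⟩
  · refine Telegraph.tendstoInDistribution_lamHat hv hX hΔ_pos hΔ hnΔ ?_
    have hlim : Tendsto (fun n : ℕ => (lam₀ : ℝ) + h / √(n * Δ n)) atTop (𝓝 (lam₀ + 0)) :=
      tendsto_const_nhds.add (tendsto_const_nhds.div_atTop hsqrt)
    rw [add_zero] at hlim
    exact hlim.congr' (hθ.mono fun n hn => hn.symm)
  · refine le_trans (le_of_eq ?_) (hS'.le_evariance hv hX hnΔ)
    rw [← ofReal_variance (memLp_id_gaussianReal 2), variance_id_gaussianReal,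
      Real.coe_toNNReal _ (le_of_lt lam₀.2)]
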